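/- **Conventions.** A real random variable $X$ has sub-Gaussian constant $b\ge 0$ if it is integrable and $\mathbb E[|X-\mathbb E X|^p]^{1/p}\le b\sqrt p$ for every real $p\ge 1$; a random vector $Y\in\mathbb R^d$ has sub-Gaussian constant $b$ if $u^{\mathsf T}Y$ does for every unit vector $u$. The maximum principal angle $\theta=\angle(V,W)\in[0,\pi/2]$ between two subspaces of $\mathbb R^d$ of the same dimension is given by $\sin\theta=\|P_V-P_W\|$ (operator norm of the difference of the orthogonal projections). A subspace $\hat\Gamma$ is spanned by top-$k$ eigenvectors of a symmetric matrix $A$ if it is the span of the first $k$ vectors of an orthonormal eigenbasis of $A$ ordered by non-increasing eigenvalue (any choice is allowed in case of ties). $\log$ is the natural logarithm. **Assumption on the means (with parameters $k\ge 1$, $\sigma>0$, $K>0$).** $\mu_1,\dots,\mu_n\in\mathbb R^d$ are independent mean-zero random vectors, almost surely in a $k$-dimensional subspace $\Gamma$; each $\mu_i$ has sub-Gaussian constant $K\sigma$, and the $k$-th largest eigenvalue of $\mathbb E[\mu_i\mu_i^{\mathsf T}]$ is at least $\sigma^2$ for every $i$. **The constant $C_*$.** For given $K$, call $C_*>1$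 *admissible* if for all $n,d,k,\sigma,\Gamma,\delta\in(0,1/2)$, all $\mu_1,\dots,\mu_n$ satisfying the assumption on the means with factor $K$, and all weights $w_i\ge 0$ with $\sum_i w_i=1$ and $\max_i w_i\le \frac{1}{C_*(k+\log(1/\delta))}$, the $k$-th largest eigenvalue of $\sum_i w_i\mu_i\mu_i^{\mathsf T}$ is at least $\sigma^2/2$ with probability at least $1-\delta/2$. **Data.** User $i\in\{1,\dots,n\}$ has $m_i\ge 2$ data points $x_{ij}=\mu_i+z_{ij}$, $1\le j\le m_i$. Conditioned on $(\mu_1,\dots,\mu_n)$, the noise vectors $z_{ij}\in\mathbb R^d$ (all $i,j$) are independent, and each $z_{ij}$ has mean zero and sub-Gaussian constant $\eta_i\ge 0$. The $z_{ij}$ need not be identically distributed, spherical, or independent of the means. Put $$\gamma_i=\Big(\frac{\eta_i^2}{\sigma^2m_i}+\frac{\eta_i^4}{\sigma^4m_i^2}\Big)^{-1}\in(0,\infty],$$ with users numbered so that $\gamma_1\ge\dots\ge\gamma_n$, let $1\le k\le n$, and put $\gamma_i'=\gamma_i$ for $i\ge k$ and $\gamma_i'=\gamma_k$ for $i<k$;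 assume $\gamma_k<\infty$. For $w_1,\dots,w_n\ge0$ let $$A=\sum_{i=1}^n\frac{w_i}{m_i(m_i-1)}\sum_{j_1\ne j_2}x_{ij_1}x_{ij_2}^{\mathsf T}.$$ **Theorem.** For every $K>0$ an admissible constant $C_*>1$ exists, and there is a constant $C>0$ depending only on $K$ such that the following holds for every admissible $C_*$. Suppose the means satisfy the assumption above with factor $K$, the data are as above, $\delta\in(0,1/2)$, and $$\sum_{i=1}^n\gamma_i'\ge C_*\,(k+\log(1/\delta))\,\gamma_1'.$$ Take $w_i=\gamma_i'/\sum_{\ell=1}^n\gamma_\ell'$. Then with probability at least $1-\delta$, every subspace $\hat\Gamma$ spanned by top-$k$ eigenvectors of $A$ satisfies $$\sin\angle(\Gamma,\hat\Gamma)\le C\sqrt{\frac{d+\log(1/\delta)}{\sum_{i=1}^n\gamma_i'}}.$$ -/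

import Mathlib

open MeasureTheory ProbabilityTheory
open scoped ENNReal

universe u

noncomputable section

/-- The Euclidean space of dimension `d`. -/
abbrev Vec (d : ℕ) : Type := EuclideanSpace ℝ (Fin d)

/-- The `d × d` matrix `x yᵀ`. -/
def outer {d : ℕ} (x y : Vec d) : Matrix (Fin d) (Fin d) ℝ :=
  Matrix.of fun a b => x a * y b

/-- A real random variable `X` has sub-Gaussian constant `b ≥ 0` if
`E[|X - E X|^p]^(1/p) ≤ b √p` for every real `p ≥ 1`. -/
def HasSubGaussianConst {Ω : Type*} [MeasurableSpace Ω] (X : Ω → ℝ) (b : ℝ) (P : Measure Ω) :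
    Prop :=
  0 ≤ b ∧ Integrable X P ∧
    ∀ p : ℝ, 1 ≤ p →
      eLpNorm (fun ω => X ω - ∫ ω', X ω' ∂P) (ENNReal.ofReal p) P
        ≤ ENNReal.ofReal (b * Real.sqrt p)

/-- A random vector has sub-Gaussian constant `b` if all its one-dimensional projections along
unit vectors do. -/
def HasSubGaussianConstVec {Ω : Type*} [MeasurableSpace Ω] {d : ℕ} (Y : Ω → Vec d) (b : ℝ)
    (P : Measure Ω) : Prop :=
  ∀ v : Vec d, ‖v‖ = 1 → HasSubGaussianConst (fun ω => inner ℝ v (Y ω)) b P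

/-- The `k`-th largest eigenvalue (`k = 1, 2, …, d`, with multiplicity) of a real symmetric
`d × d` matrix; the value `0` for other arguments is never used. -/
def kthEigenvalue {d : ℕ} (A : Matrix (Fin d) (Fin d) ℝ) (k : ℕ) : ℝ :=
  open Classical in
  if h : A.IsHermitian ∧ 1 ≤ k ∧ k ≤ Fintype.card (Fin d) then
    h.1.eigenvalues₀ ⟨k - 1, by have := h.2; omega⟩
  else 0

/-- `W` is a subspace spanned by top-`k` eigenvectors of `A`: for some orthonormal basis of
eigenvectors of `A`, ordered by non-increasing eigenvalue, `W` is spanned by the first `k`. -/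
def IsTopEigenspace {d : ℕ} (A : Matrix (Fin d) (Fin d) ℝ) (k : ℕ)
    (W : Submodule ℝ (Vec d)) : Prop :=
  ∃ (b : OrthonormalBasis (Fin d) ℝ (Vec d)) (lam : Fin d → ℝ),
    Antitone lam ∧ (∀ i, Matrix.toEuclideanLin A (b i) = lam i • b i) ∧
      W = Submodule.span ℝ (b '' {i | i.val < k})

/-- The maximum principal angle `θ ∈ [0, π/2]` between two subspaces of the same dimension:
`sin θ` is the operator norm of the difference of the two orthogonal projections. -/
def maxPrincipalAngle {d : ℕ} (V W : Submodule ℝ (Vec d)) : ℝ :=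
  Real.arcsin ‖V.starProjection - W.starProjection‖

/-- The matrix `E[Y Yᵀ]`. -/
def secondMoment {Ω : Type*} [MeasurableSpace Ω] {d : ℕ} (Y : Ω → Vec d) (P : Measure Ω) :
    Matrix (Fin d) (Fin d) ℝ :=
  Matrix.of fun a b => ∫ ω, Y ω a * Y ω b ∂P

/-- The assumption on the user-specific means `M 0, …, M (n-1)`: they are independent, mean-zero,
supported on the `k`-dimensional subspace `Γ`, with sub-Gaussian constant `K σ`, and the `k`-th
largest eigenvalue of each `E[μ_i μ_iᵀ]` is at least `σ²`. -/
structure MeansAssumption {Ω : Type*} [MeasurableSpace Ω] (P : Measure Ω) {n d : ℕ}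
    (M : Fin n → Ω → Vec d) (Γ : Submodule ℝ (Vec d)) (k : ℕ) (K σ : ℝ) : Prop where
  measurable : ∀ i, Measurable (M i)
  indep : iIndepFun M P
  mean_zero : ∀ i, ∫ ω, M i ω ∂P = 0
  finrank_eq : Module.finrank ℝ Γ = k
  supported : ∀ i, ∀ᵐ ω ∂P, M i ω ∈ Γ
  subGaussian : ∀ i, HasSubGaussianConstVec (M i) (K * σ) P
  eigenvalue_ge : ∀ i, σ ^ 2 ≤ kthEigenvalue (secondMoment (M i) P) k

/-- The assumption on the noise: under the (regular) conditional law of all noise vectors given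
all user-specific means, the noise vectors `z i j` are independent, and each `z i j` has mean zero
and sub-Gaussian constant `η i`. -/
structure NoiseAssumption {Ω : Type*} [MeasurableSpace Ω] (P : Measure Ω) [IsFiniteMeasure P]
    {n d : ℕ} (m : Fin n → ℕ) (M : Fin n → Ω → Vec d) (Z : (i : Fin n) → Fin (m i) → Ω → Vec d)
    (η : Fin n → ℝ) : Prop where
  measurable : ∀ i j, Measurable (Z i j)
  conditional : ∀ᵐ v ∂(P.map fun ω i => M i ω),
    iIndepFun (fun (p : (i : Fin n) × Fin (m i)) (z : (i : Fin n) → Fin (m i) → Vec d) =>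
        z p.1 p.2) (condDistrib (fun ω i j => Z i j ω) (fun ω i => M i ω) P v) ∧
    ∀ i j,
      ∫ z, z i j ∂(condDistrib (fun ω i j => Z i j ω) (fun ω i => M i ω) P v) = 0 ∧
      HasSubGaussianConstVec (fun z : (i : Fin n) → Fin (m i) → Vec d => z i j) (η i)
        (condDistrib (fun ω i j => Z i j ω) (fun ω i => M i ω) P v)

/-- The amount of information `(η² / (σ² m) + η⁴ / (σ⁴ m²))⁻¹ ∈ (0, ∞]` of a user with `m` data
points and noise level `η`; it is `∞` when `η = 0`. -/
def info (σ η : ℝ) (m : ℕ) : ℝ≥0∞ :=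
  (ENNReal.ofReal (η ^ 2 / (σ ^ 2 * m) + η ^ 4 / (σ ^ 4 * (m : ℝ) ^ 2)))⁻¹

/-- For `γ` sorted non-increasingly, the values of the `k - 1` most informative users are replaced
by the `k`-th one. Users are numbered `0, …, n-1` here, so the `k`-th user has number `k - 1`. -/
def truncInfo {n : ℕ} (k : ℕ) (hk : 1 ≤ k) (hkn : k ≤ n) (γ : Fin n → ℝ≥0∞) (i : Fin n) : ℝ≥0∞ :=
  if k ≤ i.val + 1 then γ i else γ ⟨k - 1, by omega⟩

/-- The weighted sum of pairwise U-statistics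
`∑ i, w i / (m i (m i - 1)) * ∑ (j₁ ≠ j₂), x i j₁ (x i j₂)ᵀ`. -/
def pairwiseMatrix {n d : ℕ} (m : Fin n → ℕ) (w : Fin n → ℝ)
    (x : (i : Fin n) → Fin (m i) → Vec d) : Matrix (Fin d) (Fin d) ℝ :=
  ∑ i, (w i / ((m i : ℝ) * ((m i : ℝ) - 1))) •
    ∑ p ∈ (Finset.univ : Finset (Fin (m i))).offDiag, outer (x i p.1) (x i p.2)

/-- `Cs > 1` is an admissible weight constant (for the sub-Gaussian factor `K`): whenever means
satisfy the assumption on the means with factor `K`, the weights `w i ≥ 0` sum to one and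
`max w i ≤ 1 / (Cs (k + log (1/δ)))`, the `k`-th largest eigenvalue of `∑ i, w i μ_i μ_iᵀ` is at
least `σ² / 2` with probability at least `1 - δ/2`. -/
def IsWeightConstant (K Cs : ℝ) : Prop :=
  1 < Cs ∧
  ∀ (Ω : Type u) [MeasurableSpace Ω] (P : Measure Ω) [IsProbabilityMeasure P]
    (n d k : ℕ) (M : Fin n → Ω → Vec d) (Γ : Submodule ℝ (Vec d)) (σ δ : ℝ) (w : Fin n → ℝ),
    1 ≤ k → 0 < σ → 0 < δ → δ < 1 / 2 →
    MeansAssumption P M Γ k K σ →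
    (∀ i, 0 ≤ w i) → ∑ i, w i = 1 →
    (∀ i, w i ≤ 1 / (Cs * (k + Real.log (1 / δ)))) →
    P {ω | ¬ σ ^ 2 / 2 ≤ kthEigenvalue (∑ i, w i • outer (M i ω) (M i ω)) k}
      ≤ ENNReal.ofReal (δ / 2)

end

/-! Dropping the pairs `j₁ = j₂` removes the noise bias. At a unit vector `u` the quadratic form of
`A` is exactly that of `T₀ = ∑ w_i μ_i μ_iᵀ`, plus `crossTerm` (linear in the noise) and `quadTerm`
(off-diagonal quadratic in the noise): `inner_pairwiseMatrix`. The range of `T₀` lies in `Γ`, and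
admissibility of the weight constant gives `T₀ ≥ σ²/2` on `Γ`. A Davis–Kahan argument
(`norm_starProjection_sub_span_le`) therefore turns a bound on the noise operator into a bound on
the angle.

The noise operator is controlled on a `1/4`-net of the unit sphere of `ℝ^d`. Let `S = ∑ γ'_i`. The
definition of `info` makes `w_i η_i²/m_i ≤ σ²/S` and `w_i (η_i²/m_i)² ≤ σ⁴/S`. Conditionally on the
means, `crossTerm` is sub-Gaussian with proxy of order `(σ²/S) ∑ w_i ⟨u, μ_i⟩²`, where the sum is
`O(K²σ²)` with high probability. `quadTerm` has exponential moments by decoupling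
(`lintegral_exp_sum_offDiag_le`). Both are of order `σ² √((d + log(1/δ))/S)` outside an event small
enough to survive the union over the net.

An admissible constant exists by the same net method inside `Γ`: a coarse net bounds the norm of the
weighted second moment matrix, and a fine net transfers a pointwise lower tail bound to the whole
sphere of `Γ`. -/

/-! ### From moment growth to exponential moments -/

section SubGaussian

variable {Ω : Type*} [MeasurableSpace Ω] {P : Measure Ω} {X : Ω → ℝ} {b : ℝ}

lemma HasSubGaussianConst.lintegral_pow_le (h : HasSubGaussianConst X b P)
    (h0 : ∫ ω, X ω ∂P = 0) {q : ℕ} (hq : 1 ≤ q) :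
    ∫⁻ ω, ENNReal.ofReal (X ω ^ (2 * q)) ∂P ≤ ENNReal.ofReal ((2 * q * b ^ 2) ^ q) := by
  obtain ⟨hb, -, hp⟩ := h
  have hq' : (1 : ℝ) ≤ q := by exact_mod_cast hq
  have h2q : (0 : ℝ) < ((2 * q : ℕ) : ℝ) := by push_cast; linarith
  have := hp ((2 * q : ℕ) : ℝ) (by push_cast; linarith)
  simp only [h0, sub_zero] at this
  rw [eLpNorm_eq_lintegral_rpow_enorm_toReal (ENNReal.ofReal_pos.2 h2q).ne' ENNReal.ofReal_ne_top,
    ENNReal.toReal_ofReal h2q.le, one_div, ENNReal.rpow_inv_le_iff h2q,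
    ENNReal.ofReal_rpow_of_nonneg (by positivity) h2q.le] at this
  have e1 : ∀ ω, ‖X ω‖ₑ ^ ((2 * q : ℕ) : ℝ) = ENNReal.ofReal (X ω ^ (2 * q)) := by
    intro ω
    rw [ENNReal.rpow_natCast, Real.enorm_eq_ofReal_abs, ← ENNReal.ofReal_pow (abs_nonneg _),
      pow_mul, sq_abs, pow_mul]
  have e2 : (b * Real.sqrt ((2 * q : ℕ) : ℝ)) ^ ((2 * q : ℕ) : ℝ) = (2 * q * b ^ 2) ^ q := by
    rw [Real.rpow_natCast, pow_mul, mul_pow, Real.sq_sqrt h2q.le]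
    push_cast; ring
  simpa only [e1, e2] using this

/-- Expand the exponential. The moment bound and `q^q/q! ≤ e^q ≤ 3^q` dominate the series by a
geometric one of ratio `x = 6ab² ≤ 1/2`, and `1/(1 - x) ≤ 1 + 2x ≤ e^(2x)`. -/
lemma HasSubGaussianConst.lintegral_exp_sq_le [IsProbabilityMeasure P]
    (h : HasSubGaussianConst X b P) (h0 : ∫ ω, X ω ∂P = 0) {a : ℝ} (ha : 0 ≤ a)
    (hab : 12 * a * b ^ 2 ≤ 1) :
    ∫⁻ ω, ENNReal.ofReal (Real.exp (a * X ω ^ 2)) ∂P ≤ ENNReal.ofReal (Real.exp (12 * a * b ^ 2)) := by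
  have hX : AEMeasurable X P := h.2.1.aemeasurable
  have hx0 : 0 ≤ 6 * a * b ^ 2 := by positivity
  have hx1 : 6 * a * b ^ 2 < 1 := by linarith
  have e1 : ∀ ω, ENNReal.ofReal (Real.exp (a * X ω ^ 2)) =
      ∑' q : ℕ, ENNReal.ofReal (a ^ q / q.factorial) * ENNReal.ofReal (X ω ^ (2 * q)) := by
    intro ω
    have hs := NormedSpace.expSeries_div_hasSum_exp (𝔸 := ℝ) (a * X ω ^ 2)
    rw [← Real.exp_eq_exp_ℝ] at hs
    rw [← hs.tsum_eq, ENNReal.ofReal_tsum_of_nonneg (fun n => by positivity) hs.summable]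
    congr 1; ext q
    rw [← ENNReal.ofReal_mul (by positivity)]
    congr 1
    rw [mul_pow, ← pow_mul]; ring
  simp_rw [e1]
  rw [lintegral_tsum (fun q => by fun_prop)]
  have e2 : ∀ q : ℕ, ∫⁻ ω, ENNReal.ofReal (a ^ q / q.factorial) * ENNReal.ofReal (X ω ^ (2 * q)) ∂P
      ≤ ENNReal.ofReal ((6 * a * b ^ 2) ^ q) := by
    intro q
    rw [lintegral_const_mul' _ _ (by simp)]
    rcases Nat.eq_zero_or_pos q with rfl | hq
    · simp
    refine (mul_le_mul_right (h.lintegral_pow_le h0 hq) _).trans ?_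
    rw [← ENNReal.ofReal_mul (by positivity)]
    apply ENNReal.ofReal_le_ofReal
    have h3 : (q : ℝ) ^ q / q.factorial ≤ 3 ^ q := by
      refine (Real.pow_div_factorial_le_exp _ (by positivity) q).trans ?_
      rw [← mul_one (q : ℝ), Real.exp_nat_mul]
      have := Real.exp_one_lt_d9
      gcongr; linarith
    calc a ^ q / q.factorial * (2 * q * b ^ 2) ^ q
        = (2 * a * b ^ 2) ^ q * ((q : ℝ) ^ q / q.factorial) := by
          rw [mul_pow, mul_pow, mul_pow, mul_pow]; ring
      _ ≤ (2 * a * b ^ 2) ^ q * 3 ^ q := by gcongr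
      _ = (6 * a * b ^ 2) ^ q := by rw [← mul_pow]; ring
  refine (ENNReal.tsum_le_tsum e2).trans ?_
  rw [← ENNReal.ofReal_tsum_of_nonneg (fun n => by positivity)
    (summable_geometric_of_lt_one hx0 hx1), tsum_geometric_of_lt_one hx0 hx1]
  apply ENNReal.ofReal_le_ofReal
  set x := 6 * a * b ^ 2 with hx
  have : 12 * a * b ^ 2 = 2 * x := by rw [hx]; ring
  rw [this] at hab ⊢
  have h1 : 1 + 2 * x ≤ Real.exp (2 * x) := by linarith [Real.add_one_le_exp (2 * x)]
  refine le_trans ?_ h1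
  rw [inv_le_comm₀ (by linarith) (by linarith), inv_le_iff_one_le_mul₀ (by linarith)]
  nlinarith

/-- Serves to bound the moment generating function of a centred variable: the linear term integrates
to zero and only the exponential of the square remains. -/
lemma Real.exp_le_add_exp_sq (x : ℝ) : Real.exp x ≤ x + Real.exp (x ^ 2) := by
  have h1 := Real.add_one_le_exp (x ^ 2)
  have h2 := Real.quadratic_le_exp_of_nonneg (sq_nonneg x)
  rcases le_total |x| 1 with hx | hx
  · have hb := Real.abs_exp_sub_one_sub_id_le hx
    have := (abs_le.1 hb).2
    linarith
  · rcases le_total 0 x with h0 | h0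
    · rw [abs_of_nonneg h0] at hx
      have : Real.exp x ≤ Real.exp (x ^ 2) := Real.exp_le_exp.2 (by nlinarith)
      linarith
    · rw [abs_of_nonpos h0] at hx
      have : Real.exp x ≤ 1 := Real.exp_le_one_iff.2 h0
      nlinarith

lemma integrable_exp_and_integral_exp_le {f : Ω → ℝ} (hf : AEMeasurable f P) {C : ℝ}
    (h : ∫⁻ ω, ENNReal.ofReal (Real.exp (f ω)) ∂P ≤ ENNReal.ofReal C) (hC : 0 ≤ C) :
    Integrable (fun ω => Real.exp (f ω)) P ∧ ∫ ω, Real.exp (f ω) ∂P ≤ C := by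
  have hm : AEStronglyMeasurable (fun ω => Real.exp (f ω)) P := by fun_prop
  have hi : Integrable (fun ω => Real.exp (f ω)) P :=
    ⟨hm, (hasFiniteIntegral_iff_ofReal (ae_of_all _ fun ω => (Real.exp_pos _).le)).2
      (h.trans_lt ENNReal.ofReal_lt_top)⟩
  refine ⟨hi, ?_⟩
  rw [integral_eq_lintegral_of_nonneg_ae (ae_of_all _ fun ω => (Real.exp_pos _).le) hm]
  exact ENNReal.toReal_le_of_le_ofReal hC h

/-- For small `t` use `e^y ≤ y + e^(y²)` and centring. For large `t` complete the square, `tX ≤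
6t²b² + X²/(24b²)`; the second term costs a factor `e^(1/2)`, absorbed because `12t²b² ≥ 1`. -/
lemma HasSubGaussianConst.hasSubgaussianMGF [IsProbabilityMeasure P]
    (h : HasSubGaussianConst X b P) (h0 : ∫ ω, X ω ∂P = 0) :
    HasSubgaussianMGF X (Real.toNNReal (24 * b ^ 2)) P := by
  have hX : AEMeasurable X P := h.2.1.aemeasurable
  have key : ∀ t : ℝ, Integrable (fun ω => Real.exp (t * X ω)) P ∧
      ∫ ω, Real.exp (t * X ω) ∂P ≤ Real.exp (12 * t ^ 2 * b ^ 2) := by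
    intro t
    rcases le_total (12 * t ^ 2 * b ^ 2) 1 with ht | ht
    · have hsq := integrable_exp_and_integral_exp_le (by fun_prop)
        (h.lintegral_exp_sq_le h0 (sq_nonneg t) ht) (Real.exp_pos _).le
      have hint : Integrable (fun ω => t * X ω + Real.exp (t ^ 2 * X ω ^ 2)) P :=
        (h.2.1.const_mul t).add hsq.1
      have hle : ∀ ω, Real.exp (t * X ω) ≤ t * X ω + Real.exp (t ^ 2 * X ω ^ 2) := by
        intro ω
        have := Real.exp_le_add_exp_sq (t * X ω)
        rwa [mul_pow] at this
      have hi : Integrable (fun ω => Real.exp (t * X ω)) P := by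
        refine hint.mono' (by fun_prop) (ae_of_all _ fun ω => ?_)
        rw [Real.norm_of_nonneg (Real.exp_pos _).le]
        exact hle ω
      refine ⟨hi, (integral_mono hi hint hle).trans ?_⟩
      rw [integral_add (h.2.1.const_mul t) hsq.1, integral_const_mul, h0, mul_zero, zero_add]
      exact hsq.2
    · have hb : 0 < b ^ 2 := by
        rcases (sq_nonneg b).lt_or_eq with hb | hb
        · exact hb
        · rw [← hb] at ht; norm_num at ht
      have hb0 : b ≠ 0 := by rintro rfl; simp at hb
      refine integrable_exp_and_integral_exp_le (by fun_prop) ?_ (Real.exp_pos _).le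
      have hle : ∀ ω, ENNReal.ofReal (Real.exp (t * X ω)) ≤
          ENNReal.ofReal (Real.exp (6 * t ^ 2 * b ^ 2)) *
            ENNReal.ofReal (Real.exp (1 / (24 * b ^ 2) * X ω ^ 2)) := by
        intro ω
        rw [← ENNReal.ofReal_mul (Real.exp_pos _).le, ← Real.exp_add]
        apply ENNReal.ofReal_le_ofReal
        apply Real.exp_le_exp.2
        have : 6 * t ^ 2 * b ^ 2 + 1 / (24 * b ^ 2) * X ω ^ 2 - t * X ω =
          (12 * t * b ^ 2 - X ω) ^ 2 / (24 * b ^ 2) := by field_simp; ring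
        have : 0 ≤ (12 * t * b ^ 2 - X ω) ^ 2 / (24 * b ^ 2) := by positivity
        linarith
      refine (lintegral_mono hle).trans ?_
      rw [lintegral_const_mul' _ _ (by simp)]
      have h12 : 12 * (1 / (24 * b ^ 2)) * b ^ 2 = 1 / 2 := by
        field_simp
        norm_num
      refine (mul_le_mul_right (h.lintegral_exp_sq_le h0 (by positivity) (by rw [h12]; norm_num))
        _).trans ?_
      rw [← ENNReal.ofReal_mul (Real.exp_pos _).le, ← Real.exp_add, h12]
      apply ENNReal.ofReal_le_ofReal
      apply Real.exp_le_exp.2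
      linarith
  refine ⟨fun t => (key t).1, fun t => (key t).2.trans ?_⟩
  rw [Real.coe_toNNReal _ (by positivity)]
  apply Real.exp_le_exp.2
  linarith

end SubGaussian

/-! ### Exponential moments of squares -/

section ExpSquare

variable {Ω : Type*} [MeasurableSpace Ω] {P : Measure Ω} {S : Ω → ℝ} {c : NNReal}

lemma ProbabilityTheory.HasSubgaussianMGF.lintegral_exp_le (h : HasSubgaussianMGF S c P) (t : ℝ) :
    ∫⁻ ω, ENNReal.ofReal (Real.exp (t * S ω)) ∂P ≤ ENNReal.ofReal (Real.exp (c * t ^ 2 / 2)) := by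
  rw [← ofReal_integral_eq_lintegral_ofReal (h.integrable_exp_mul t)
    (ae_of_all _ fun ω => (Real.exp_pos _).le)]
  exact ENNReal.ofReal_le_ofReal (h.mgf_le t)

lemma lintegral_gaussian {b : ℝ} (hb : 0 < b) :
    ∫⁻ x : ℝ, ENNReal.ofReal (Real.exp (-b * x ^ 2)) = ENNReal.ofReal (Real.sqrt (Real.pi / b)) := by
  rw [← ofReal_integral_eq_lintegral_ofReal (integrable_exp_neg_mul_sq hb)
    (ae_of_all _ fun ω => (Real.exp_pos _).le), integral_gaussian]

/-- Exponential moments of the square of a random variable with a sub-Gaussian moment generating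
function, obtained by integrating the latter against a Gaussian weight. -/
lemma ProbabilityTheory.HasSubgaussianMGF.lintegral_exp_sq_le [SFinite P]
    (h : HasSubgaussianMGF S c P)
    (hS : Measurable S) {a : ℝ} (ha : 0 ≤ a) (hac : a * c ≤ 1 / 4) :
    ∫⁻ ω, ENNReal.ofReal (Real.exp (a * S ω ^ 2)) ∂P ≤ ENNReal.ofReal (Real.exp (2 * a * c)) := by
  -- With this `r`, a standard Gaussian `g` satisfies `E e^(r g S) = e^(r²S²/2) = e^(aS²)`, which
  -- linearises the square.
  set r := Real.sqrt (2 * a)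
  have hr : r ^ 2 = 2 * a := Real.sq_sqrt (by positivity)
  have hpi := Real.pi_pos
  have hc : (0 : ℝ) ≤ c := c.2
  set N := ENNReal.ofReal (Real.sqrt (Real.pi / (1 / 2)))
  have hN0 : N ≠ 0 := by simp [N]; positivity
  have hNt : N ≠ ∞ := ENNReal.ofReal_ne_top
  have e1 : ∀ ω, N * ENNReal.ofReal (Real.exp (a * S ω ^ 2)) =
      ∫⁻ g : ℝ, ENNReal.ofReal (Real.exp (r * g * S ω)) *
        ENNReal.ofReal (Real.exp (-(1 / 2) * g ^ 2)) := by
    intro ω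
    have : ∀ g : ℝ, ENNReal.ofReal (Real.exp (r * g * S ω)) *
        ENNReal.ofReal (Real.exp (-(1 / 2) * g ^ 2)) = ENNReal.ofReal (Real.exp (a * S ω ^ 2)) *
          ENNReal.ofReal (Real.exp (-(1 / 2) * (g - r * S ω) ^ 2)) := by
      intro g
      rw [← ENNReal.ofReal_mul (Real.exp_pos _).le, ← Real.exp_add,
        ← ENNReal.ofReal_mul (Real.exp_pos _).le, ← Real.exp_add]
      congr 2
      linear_combination (S ω ^ 2 / 2) * hr
    simp_rw [this]
    rw [lintegral_const_mul' _ _ (by simp), lintegral_sub_right_eq_self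
      (fun g => ENNReal.ofReal (Real.exp (-(1 / 2) * g ^ 2))), lintegral_gaussian (by norm_num),
      mul_comm]
  have h2 : N * ∫⁻ ω, ENNReal.ofReal (Real.exp (a * S ω ^ 2)) ∂P ≤
      ENNReal.ofReal (Real.sqrt (Real.pi / (1 / 2 - a * c))) := by
    rw [← lintegral_const_mul' _ _ hNt]
    simp_rw [e1]
    rw [lintegral_lintegral_swap (by fun_prop)]
    rw [← lintegral_gaussian (by linarith)]
    refine lintegral_mono fun g => ?_
    rw [lintegral_mul_const' _ _ (by simp)]
    refine (mul_le_mul_left (h.lintegral_exp_le (r * g)) _).trans ?_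
    rw [← ENNReal.ofReal_mul (Real.exp_pos _).le, ← Real.exp_add]
    apply ENNReal.ofReal_le_ofReal
    apply Real.exp_le_exp.2
    apply le_of_eq
    linear_combination (g ^ 2 * c / 2) * hr
  rw [← ENNReal.mul_le_mul_iff_right hN0 hNt]
  refine h2.trans ?_
  rw [← ENNReal.ofReal_mul (by positivity)]
  apply ENNReal.ofReal_le_ofReal
  rw [Real.sqrt_le_left (by positivity), mul_pow, Real.sq_sqrt (by positivity), ← Real.exp_nat_mul]
  have h3 := Real.add_one_le_exp ((2 : ℕ) * (2 * a * c) : ℝ)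
  push_cast at h3 ⊢
  set x := a * (c : ℝ)
  have hx : 0 ≤ x := by positivity
  rw [div_le_iff₀ (by linarith)]
  -- `(1 + 4x)(1 - 2x) = 1 + 2x(1 - 4x)`, so this is where `x = ac ≤ 1/4` enters.
  have h4 : 1 ≤ Real.exp (2 * (2 * a * c)) * (1 - 2 * x) := by
    have : (1 + 4 * x) * (1 - 2 * x) ≤ Real.exp (2 * (2 * a * c)) * (1 - 2 * x) := by
      apply mul_le_mul_of_nonneg_right _ (by linarith)
      simp only [x]; linarith
    nlinarith
  calc Real.pi = Real.pi * 1 := by ring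
    _ ≤ Real.pi * (Real.exp (2 * (2 * a * c)) * (1 - 2 * x)) := by gcongr
    _ = _ := by ring

end ExpSquare

/-! ### Decoupling of off-diagonal sums -/

section Decoupling

variable {ι : Type*} [DecidableEq ι]

lemma Finset.sum_offDiag_mul_self (s : Finset ι) (y : ι → ℝ) :
    ∑ p ∈ s.offDiag, y p.1 * y p.2 = (∑ j ∈ s, y j) ^ 2 - ∑ j ∈ s, y j ^ 2 := by
  have h : ∑ p ∈ s ×ˢ s, y p.1 * y p.2 =
      ∑ p ∈ s.diag, y p.1 * y p.2 + ∑ p ∈ s.offDiag, y p.1 * y p.2 := by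
    rw [← Finset.diag_union_offDiag, Finset.sum_union (Finset.disjoint_diag_offDiag s)]
  rw [Finset.sum_product, Finset.sum_diag, ← Finset.sum_mul_sum] at h
  have : ∑ j ∈ s, y j * y j = ∑ j ∈ s, y j ^ 2 := Finset.sum_congr rfl fun _ _ => by ring
  rw [this] at h
  linarith

/-- An ordered pair of distinct indices has its first entry in `I` and its second outside for
exactly a quarter of the subsets `I`. This is decoupling by random selectors, written as a finite
average. -/
lemma Finset.sum_powerset_mul_sdiff (s : Finset ι) (y : ι → ℝ) :
    4 * ∑ I ∈ s.powerset, (∑ j ∈ I, y j) * ∑ j ∈ s \ I, y j =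
      2 ^ s.card * ((∑ j ∈ s, y j) ^ 2 - ∑ j ∈ s, y j ^ 2) := by
  induction s using Finset.induction_on with
  | empty => simp
  | insert a s ha ih =>
    rw [Finset.sum_powerset_insert ha, Finset.card_insert_of_notMem ha, Finset.sum_insert ha,
      Finset.sum_insert ha]
    have h1 : ∑ I ∈ s.powerset, (∑ j ∈ I, y j) * ∑ j ∈ insert a s \ I, y j =
        ∑ I ∈ s.powerset, ((∑ j ∈ I, y j) * ∑ j ∈ s \ I, y j + y a * ∑ j ∈ I, y j) := by
      refine Finset.sum_congr rfl fun I hI => ?_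
      have haI : a ∉ I := fun h => ha (Finset.mem_powerset.1 hI h)
      rw [Finset.insert_sdiff_of_notMem _ haI, Finset.sum_insert (by simp [ha])]
      ring
    have h2 : ∑ I ∈ s.powerset, (∑ j ∈ insert a I, y j) * ∑ j ∈ insert a s \ insert a I, y j =
        ∑ I ∈ s.powerset, ((∑ j ∈ I, y j) * ∑ j ∈ s \ I, y j + y a * ∑ j ∈ s \ I, y j) := by
      refine Finset.sum_congr rfl fun I hI => ?_
      have haI : a ∉ I := fun h => ha (Finset.mem_powerset.1 hI h)
      rw [Finset.insert_sdiff_insert, Finset.sdiff_insert_of_notMem ha, Finset.sum_insert haI]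
      ring
    have h3 : ∑ I ∈ s.powerset, (y a * ∑ j ∈ I, y j) + ∑ I ∈ s.powerset, (y a * ∑ j ∈ s \ I, y j) =
        2 ^ s.card * (y a * ∑ j ∈ s, y j) := by
      rw [← Finset.sum_add_distrib, Finset.sum_congr rfl (g := fun _ => y a * ∑ j ∈ s, y j)]
      · simp
      · intro I hI
        rw [← mul_add, add_comm, Finset.sum_sdiff (Finset.mem_powerset.1 hI)]
    rw [h1, h2, Finset.sum_add_distrib, Finset.sum_add_distrib, pow_succ]
    linear_combination 2 * ih + 4 * h3

/-- Jensen's inequality for the average over `I`: each term is now a product of sums over disjoint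
index sets, hence of independent variables. -/
lemma exp_sum_offDiag_le [Fintype ι] (a : ℝ) (y : ι → ℝ) :
    Real.exp (a * ∑ p ∈ (Finset.univ : Finset ι).offDiag, y p.1 * y p.2) ≤
      ∑ I : Finset ι, (2 ^ Fintype.card ι)⁻¹ *
        Real.exp (4 * a * (∑ j ∈ I, y j) * ∑ j ∈ Iᶜ, y j) := by
  have h := Finset.sum_powerset_mul_sdiff (Finset.univ : Finset ι) y
  rw [← Finset.sum_offDiag_mul_self, Finset.powerset_univ, Finset.card_univ] at h
  have e : a * ∑ p ∈ (Finset.univ : Finset ι).offDiag, y p.1 * y p.2 =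
      ∑ I : Finset ι, (2 ^ Fintype.card ι : ℝ)⁻¹ • (4 * a * (∑ j ∈ I, y j) * ∑ j ∈ Iᶜ, y j) := by
    have h2 : ∀ I : Finset ι, (2 ^ Fintype.card ι : ℝ)⁻¹ • (4 * a * (∑ j ∈ I, y j) * ∑ j ∈ Iᶜ, y j) =
      (4 * a * (2 ^ Fintype.card ι : ℝ)⁻¹) * ((∑ j ∈ I, y j) * ∑ j ∈ Finset.univ \ I, y j) := by
      intro I
      rw [smul_eq_mul, Finset.compl_eq_univ_sdiff]; ring
    simp_rw [h2]
    rw [← Finset.mul_sum]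
    have hp : (2 ^ Fintype.card ι : ℝ) ≠ 0 := by positivity
    rw [show ∑ p ∈ (Finset.univ : Finset ι).offDiag, y p.1 * y p.2 = (2 ^ Fintype.card ι : ℝ)⁻¹ *
      (4 * ∑ I : Finset ι, (∑ j ∈ I, y j) * ∑ j ∈ Finset.univ \ I, y j) by
        rw [h, inv_mul_cancel_left₀ hp]]
    ring
  rw [e]
  exact convexOn_exp.map_sum_le (fun _ _ => by positivity) (by simp) (fun _ _ => Set.mem_univ _)

end Decoupling

/-! ### Independence, off-diagonal forms and tail bounds -/

section Independence

variable {Ω : Type*} [MeasurableSpace Ω] {P : Measure Ω}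

lemma ProbabilityTheory.IndepFun.lintegral_comp_prod [IsFiniteMeasure P] {U T : Ω → ℝ}
    (h : IndepFun U T P)
    (hU : Measurable U) (hT : Measurable T) {f : ℝ × ℝ → ℝ≥0∞} (hf : Measurable f) :
    ∫⁻ ω, f (U ω, T ω) ∂P = ∫⁻ ω, ∫⁻ ω', f (U ω', T ω) ∂P ∂P := by
  rw [← lintegral_map (f := f) (g := fun ω => (U ω, T ω)) hf (by fun_prop),
    (indepFun_iff_map_prod_eq_prod_map_map hU.aemeasurable hT.aemeasurable).1 h,
    lintegral_prod_symm _ hf.aemeasurable, lintegral_map (by fun_prop) hT]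
  refine lintegral_congr fun ω => ?_
  rw [lintegral_map (by fun_prop) hU]

/-- Integrating out `U` with `T` frozen leaves `exp(c₁r²T²/2)`, to which the bound on exponential
moments of squares applies. -/
lemma ProbabilityTheory.HasSubgaussianMGF.lintegral_exp_mul_le [IsFiniteMeasure P] {U T : Ω → ℝ}
    {c₁ c₂ : NNReal}
    (hU : HasSubgaussianMGF U c₁ P) (hT : HasSubgaussianMGF T c₂ P) (h : IndepFun U T P)
    (hmU : Measurable U) (hmT : Measurable T) {r : ℝ} (hr : r ^ 2 * c₁ * c₂ ≤ 1 / 2) :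
    ∫⁻ ω, ENNReal.ofReal (Real.exp (r * U ω * T ω)) ∂P ≤
      ENNReal.ofReal (Real.exp (r ^ 2 * c₁ * c₂)) := by
  rw [h.lintegral_comp_prod hmU hmT (f := fun p => ENNReal.ofReal (Real.exp (r * p.1 * p.2)))
    (by fun_prop)]
  have h1 : ∀ ω, ∫⁻ ω', ENNReal.ofReal (Real.exp (r * U ω' * T ω)) ∂P ≤
      ENNReal.ofReal (Real.exp (c₁ * r ^ 2 / 2 * T ω ^ 2)) := by
    intro ω
    have := hU.lintegral_exp_le (r * T ω)
    have e1 : ∀ ω', r * T ω * U ω' = r * U ω' * T ω := fun ω' => by ring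
    have e2 : c₁ * (r * T ω) ^ 2 / 2 = c₁ * r ^ 2 / 2 * T ω ^ 2 := by ring
    simpa only [e1, e2] using this
  refine (lintegral_mono h1).trans ?_
  refine (hT.lintegral_exp_sq_le hmT (by positivity) (by linarith)).trans ?_
  apply le_of_eq; ring_nf

/-- Exponential moments of an off-diagonal quadratic form in independent sub-Gaussian variables. -/
lemma lintegral_exp_sum_offDiag_le {ι : Type*} [Fintype ι] [DecidableEq ι] {y : ι → Ω → ℝ}
    {c : NNReal}
    (hy : iIndepFun y P) (hm : ∀ j, Measurable (y j)) (hc : ∀ j, HasSubgaussianMGF (y j) c P)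
    {a : ℝ} (ha : 4 * a ^ 2 * c ^ 2 * Fintype.card ι ^ 2 ≤ 1 / 2) :
    ∫⁻ ω, ENNReal.ofReal (Real.exp (a * ∑ p ∈ (Finset.univ : Finset ι).offDiag,
      y p.1 ω * y p.2 ω)) ∂P ≤
      ENNReal.ofReal (Real.exp (4 * a ^ 2 * c ^ 2 * Fintype.card ι ^ 2)) := by
  have := hy.isProbabilityMeasure
  set N : ℝ := (Fintype.card ι : ℝ) with hNdef
  have hI : ∀ I : Finset ι,
      ∫⁻ ω, ENNReal.ofReal (Real.exp (4 * a * (∑ j ∈ I, y j ω) * ∑ j ∈ Iᶜ, y j ω)) ∂P ≤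
        ENNReal.ofReal (Real.exp (4 * a ^ 2 * c ^ 2 * N ^ 2)) := by
    intro I
    have h1 : HasSubgaussianMGF (fun ω => ∑ j ∈ I, y j ω) (∑ j ∈ I, c) P :=
      HasSubgaussianMGF.sum_of_iIndepFun hy fun j _ => hc j
    have h2 : HasSubgaussianMGF (fun ω => ∑ j ∈ Iᶜ, y j ω) (∑ j ∈ Iᶜ, c) P :=
      HasSubgaussianMGF.sum_of_iIndepFun hy fun j _ => hc j
    have hind : IndepFun (fun ω => ∑ j ∈ I, y j ω) (fun ω => ∑ j ∈ Iᶜ, y j ω) P := by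
      have h := (hy.indepFun_finset I Iᶜ disjoint_compl_right hm).comp
        (φ := fun v => ∑ j, v j) (ψ := fun v => ∑ j, v j) (by fun_prop) (by fun_prop)
      convert h using 1
      · ext ω; exact (Finset.sum_coe_sort I (fun j => y j ω)).symm
      · ext ω; exact (Finset.sum_coe_sort Iᶜ (fun j => y j ω)).symm
    -- By AM–GM, `4|I||Iᶜ| ≤ N²`, so the bound is uniform in the split.
    have hle : (4 * a) ^ 2 * ((∑ j ∈ I, c : NNReal) : ℝ) * ((∑ j ∈ Iᶜ, c : NNReal) : ℝ) ≤
        4 * a ^ 2 * c ^ 2 * N ^ 2 := by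
      simp only [Finset.sum_const, nsmul_eq_mul, NNReal.coe_mul, NNReal.coe_natCast]
      have hN : (I.card : ℝ) + (Iᶜ.card : ℝ) = N := by
        rw [hNdef]; exact_mod_cast Finset.card_add_card_compl I
      rw [← hN]
      have : 0 ≤ 4 * a ^ 2 * (c : ℝ) ^ 2 * ((I.card : ℝ) - (Iᶜ.card : ℝ)) ^ 2 := by positivity
      linarith
    refine (h1.lintegral_exp_mul_le h2 hind (by fun_prop) (by fun_prop) (hle.trans ha)).trans ?_
    exact ENNReal.ofReal_le_ofReal (Real.exp_le_exp.2 hle)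
  calc _ ≤ ∫⁻ ω, ∑ I : Finset ι, ENNReal.ofReal (2 ^ Fintype.card ι)⁻¹ *
        ENNReal.ofReal (Real.exp (4 * a * (∑ j ∈ I, y j ω) * ∑ j ∈ Iᶜ, y j ω)) ∂P := by
        refine lintegral_mono fun ω => ?_
        simp_rw [← ENNReal.ofReal_mul (show (0 : ℝ) ≤ (2 ^ Fintype.card ι)⁻¹ by positivity)]
        rw [← ENNReal.ofReal_sum_of_nonneg fun _ _ => by positivity]
        exact ENNReal.ofReal_le_ofReal (exp_sum_offDiag_le a fun j => y j ω)
    _ = ∑ I : Finset ι, ENNReal.ofReal (2 ^ Fintype.card ι)⁻¹ *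
        ∫⁻ ω, ENNReal.ofReal (Real.exp (4 * a * (∑ j ∈ I, y j ω) * ∑ j ∈ Iᶜ, y j ω)) ∂P := by
        rw [lintegral_finsetSum _ fun I _ => by fun_prop]
        exact Finset.sum_congr rfl fun I _ => lintegral_const_mul' _ _ (by simp)
    _ ≤ ∑ I : Finset ι, ENNReal.ofReal (2 ^ Fintype.card ι)⁻¹ *
        ENNReal.ofReal (Real.exp (4 * a ^ 2 * c ^ 2 * N ^ 2)) :=
        Finset.sum_le_sum fun I _ => mul_le_mul_right (hI I) _
    _ = ENNReal.ofReal (Real.exp (4 * a ^ 2 * c ^ 2 * N ^ 2)) := by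
        rw [Finset.sum_const, nsmul_eq_mul, ← mul_assoc, ← ENNReal.ofReal_natCast,
          ← ENNReal.ofReal_mul (by positivity)]
        simp

/-- Joint independence of all variables makes the blocks with distinct first index independent. The
quadratic noise term mixes variables within a user only, so its exponential moment factors over
users. -/
lemma ProbabilityTheory.iIndepFun.lintegral_prod_sigma {ι : Type*} [DecidableEq ι] {κ : ι → Type*}
    [∀ i, Fintype (κ i)] {y : (Σ i, κ i) → Ω → ℝ} (hy : iIndepFun y P)
    (hm : ∀ p, Measurable (y p)) (F : (i : ι) → (κ i → ℝ) → ℝ≥0∞) (hF : ∀ i, Measurable (F i))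
    (s : Finset ι) :
    ∫⁻ ω, ∏ i ∈ s, F i (fun j => y ⟨i, j⟩ ω) ∂P = ∏ i ∈ s, ∫⁻ ω, F i (fun j => y ⟨i, j⟩ ω) ∂P := by
  classical
  have := hy.isProbabilityMeasure
  induction s using Finset.induction_on with
  | empty => simp
  | insert a s ha ih =>
    simp_rw [Finset.prod_insert ha]
    rw [lintegral_mul_eq_lintegral_mul_lintegral_of_indepFun'' (by fun_prop) (by fun_prop), ih]
    have hdisj : Disjoint (({a} : Finset ι).sigma fun i => (Finset.univ : Finset (κ i)))
        (s.sigma fun i => Finset.univ) := by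
      rw [Finset.disjoint_left]
      rintro ⟨i, j⟩ h1 h2
      simp only [Finset.mem_sigma, Finset.mem_singleton, Finset.mem_univ, and_true] at h1 h2
      exact ha (h1 ▸ h2)
    have h := (hy.indepFun_finset _ _ hdisj hm).comp
      (φ := fun v => F a (fun j => v ⟨⟨a, j⟩, by simp⟩))
      (ψ := fun v => ∏ i : s, F i (fun j => v ⟨⟨i, j⟩, by simp⟩))
      ((hF a).comp (measurable_pi_lambda _ fun j => measurable_pi_apply _))
      (Finset.measurable_fun_prod _ fun i _ =>
        (hF i).comp (measurable_pi_lambda _ fun j => measurable_pi_apply _))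
    convert h using 1
    · rfl
    funext ω
    exact (Finset.prod_coe_sort s (fun i => F i (fun j => y ⟨i, j⟩ ω))).symm

/-- Markov's inequality for exponential moments. -/
lemma measure_le_of_lintegral_exp_le {f : Ω → ℝ} (hf : AEMeasurable f P) {B t : ℝ}
    (h : ∫⁻ ω, ENNReal.ofReal (Real.exp (f ω)) ∂P ≤ ENNReal.ofReal (Real.exp B)) :
    P {ω | t ≤ f ω} ≤ ENNReal.ofReal (Real.exp (B - t)) := by
  have h1 := mul_meas_ge_le_lintegral₀ (μ := P) (f := fun ω => ENNReal.ofReal (Real.exp (f ω)))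
    (by fun_prop) (ENNReal.ofReal (Real.exp t))
  have h2 : {ω | ENNReal.ofReal (Real.exp t) ≤ ENNReal.ofReal (Real.exp (f ω))} =
      {ω | t ≤ f ω} := by
    ext ω
    simp [ENNReal.ofReal_le_ofReal_iff (Real.exp_pos _).le]
  rw [h2] at h1
  have h3 := h1.trans h
  rw [Real.exp_sub, ENNReal.ofReal_div_of_pos (Real.exp_pos _), ENNReal.le_div_iff_mul_le
    (Or.inl (by simp [Real.exp_pos])) (Or.inl (by simp)), mul_comm]
  exact h3

lemma measure_biUnion_finset_le_card_mul {α : Type*} (N : Finset α) (B : α → Set Ω) {G : ℝ}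
    {e : ℝ} (hG : (N.card : ℝ) ≤ G) (h : ∀ u ∈ N, P (B u) ≤ ENNReal.ofReal e) :
    P (⋃ u ∈ N, B u) ≤ ENNReal.ofReal (G * e) := by
  refine (measure_biUnion_finset_le N B).trans ((Finset.sum_le_sum h).trans ?_)
  rw [Finset.sum_const, nsmul_eq_mul, ENNReal.ofReal_mul ((Nat.cast_nonneg _).trans hG),
    ← ENNReal.ofReal_natCast]
  gcongr

end Independence

/-! ### Nets of the unit sphere -/

section Nets

variable {E : Type*} [NormedAddCommGroup E] [NormedSpace ℝ E] [FiniteDimensional ℝ E]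

/-- Volume comparison: the balls of radius `ε/2` about the points are disjoint and lie in the ball
of radius `1 + ε/2`. -/
lemma card_le_of_separated_of_norm_eq_one {ε : ℝ} (hε : 0 < ε) (s : Finset E)
    (hs : ∀ c ∈ s, ‖c‖ = 1) (h : ∀ c ∈ s, ∀ d ∈ s, c ≠ d → ε ≤ ‖c - d‖) :
    (s.card : ℝ) ≤ (1 + 2 / ε) ^ Module.finrank ℝ E := by
  borelize E
  let μ : Measure E := Measure.addHaar
  have D : Set.Pairwise (s : Set E) (Function.onFun Disjoint fun c => Metric.ball (c : E) (ε / 2)) := by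
    rintro c hc d hd hcd
    apply Metric.ball_disjoint_ball
    rw [dist_eq_norm]
    linarith [h c hc d hd hcd]
  have hsub : (⋃ c ∈ s, Metric.ball (c : E) (ε / 2)) ⊆ Metric.ball (0 : E) (1 + ε / 2) := by
    refine Set.iUnion₂_subset fun x hx => Metric.ball_subset_ball' ?_
    rw [dist_zero_right, hs x hx]; linarith
  have I : (s.card : ℝ≥0∞) * ENNReal.ofReal ((ε / 2) ^ Module.finrank ℝ E) * μ (Metric.ball 0 1) ≤
      ENNReal.ofReal ((1 + ε / 2) ^ Module.finrank ℝ E) * μ (Metric.ball 0 1) :=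
    calc _ = μ (⋃ c ∈ s, Metric.ball (c : E) (ε / 2)) := by
          rw [measure_biUnion_finset D fun c _ => measurableSet_ball]
          simp only [μ.addHaar_ball_of_pos _ (half_pos hε), Finset.sum_const, nsmul_eq_mul, mul_assoc]
      _ ≤ μ (Metric.ball (0 : E) (1 + ε / 2)) := measure_mono hsub
      _ = _ := by rw [μ.addHaar_ball_of_pos _ (by positivity)]
  have J := (ENNReal.mul_le_mul_iff_left (Metric.measure_ball_pos _ _ zero_lt_one).ne'
    measure_ball_lt_top.ne).1 I
  have K := ENNReal.toReal_le_of_le_ofReal (by positivity) J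
  rw [ENNReal.toReal_mul, ENNReal.toReal_natCast, ENNReal.toReal_ofReal (by positivity),
    ← le_div_iff₀ (by positivity), ← div_pow] at K
  refine K.trans (le_of_eq ?_)
  congr 1
  field_simp
  ring

/-- A separated set always obeys the cardinality bound, so if no net of that size existed it could
be enlarged forever, contradicting the volume bound. -/
lemma exists_net_unitSphere (E : Type*) [NormedAddCommGroup E] [NormedSpace ℝ E]
    [FiniteDimensional ℝ E] {ε : ℝ} (hε : 0 < ε) :
    ∃ N : Finset E, (∀ u ∈ N, ‖u‖ = 1) ∧ (N.card : ℝ) ≤ (1 + 2 / ε) ^ Module.finrank ℝ E ∧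
      ∀ x : E, ‖x‖ = 1 → ∃ u ∈ N, ‖x - u‖ ≤ ε := by
  classical
  by_contra! hcon
  have key : ∀ n : ℕ, ∃ s : Finset E, s.card = n ∧ (∀ c ∈ s, ‖c‖ = 1) ∧
      ∀ c ∈ s, ∀ d ∈ s, c ≠ d → ε ≤ ‖c - d‖ := by
    intro n
    induction n with
    | zero => exact ⟨∅, by simp⟩
    | succ n ih =>
      obtain ⟨s, hn, h1, h2⟩ := ih
      obtain ⟨x, hx, hxs⟩ := hcon s h1 (card_le_of_separated_of_norm_eq_one hε s h1 h2)
      have hxm : x ∉ s := fun hm => by have := hxs x hm; simp at this; linarith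
      refine ⟨insert x s, by rw [Finset.card_insert_of_notMem hxm, hn], ?_, ?_⟩
      · intro c hc
        rcases Finset.mem_insert.1 hc with rfl | hc
        exacts [hx, h1 c hc]
      · intro c hc d hd hcd
        rcases Finset.mem_insert.1 hc with rfl | hc' <;> rcases Finset.mem_insert.1 hd with rfl | hd'
        · exact absurd rfl hcd
        · exact (hxs d hd').le
        · rw [norm_sub_rev]; exact (hxs c hc').le
        · exact h2 c hc' d hd' hcd
  obtain ⟨n, hn⟩ := exists_nat_gt ((1 + 2 / ε) ^ Module.finrank ℝ E)
  obtain ⟨s, rfl, h1, h2⟩ := key n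
  exact absurd (card_le_of_separated_of_norm_eq_one hε s h1 h2) (not_le.2 hn)

end Nets

/-! ### Norms of symmetric operators through their quadratic forms -/

section Symmetric

variable {E : Type*} [NormedAddCommGroup E] [InnerProductSpace ℝ E]

lemma norm_le_of_abs_inner_self_le {T : E →L[ℝ] E} (hT : (T : E →ₗ[ℝ] E).IsSymmetric) {S : ℝ}
    (hS : 0 ≤ S) (h : ∀ x, ‖x‖ = 1 → |inner ℝ x (T x)| ≤ S) : ‖T‖ ≤ S := by
  have h' : ∀ x, |inner ℝ x (T x)| ≤ S * ‖x‖ ^ 2 := by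
    intro x
    rcases eq_or_ne x 0 with rfl | hx
    · simp
    have hx' : 0 < ‖x‖ := norm_pos_iff.2 hx
    have := h (‖x‖⁻¹ • x) (by rw [norm_smul, norm_inv, norm_norm, inv_mul_cancel₀ hx'.ne'])
    rw [map_smul, inner_smul_left, inner_smul_right, RCLike.conj_to_real, ← mul_assoc, abs_mul,
      abs_of_pos (by positivity)] at this
    calc |inner ℝ x (T x)| = (‖x‖⁻¹ * ‖x‖⁻¹ * |inner ℝ x (T x)|) * ‖x‖ ^ 2 := by field_simp
      _ ≤ S * ‖x‖ ^ 2 := by gcongr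
  have pol : ∀ x y, 4 * inner ℝ y (T x) = inner ℝ (x + y) (T (x + y)) - inner ℝ (x - y) (T (x - y)) := by
    intro x y
    have hs : inner ℝ x (T y) = inner ℝ y (T x) := by
      rw [← real_inner_comm]; exact hT y x
    simp only [map_add, map_sub, inner_add_left, inner_add_right, inner_sub_left, inner_sub_right]
    linarith
  have bil : ∀ x y, inner ℝ y (T x) ≤ S * (‖x‖ ^ 2 + ‖y‖ ^ 2) / 2 := by
    intro x y
    have h1 := (abs_le.1 (h' (x + y))).2
    have h2 := (abs_le.1 (h' (x - y))).1
    have h3 := parallelogram_law_with_norm ℝ x y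
    have h4 := pol x y
    have h5 : S * ‖x + y‖ ^ 2 + S * ‖x - y‖ ^ 2 = 2 * (S * (‖x‖ ^ 2 + ‖y‖ ^ 2)) := by
      linear_combination S * h3
    linarith
  refine T.opNorm_le_bound hS fun x => ?_
  rcases eq_or_ne (T x) 0 with h0 | h0
  · rw [h0, norm_zero]; positivity
  rcases eq_or_ne x 0 with rfl | hx
  · simp
  have hT0 : 0 < ‖T x‖ := norm_pos_iff.2 h0
  -- The test vector points along `T x` and has the length of `x`, which balances the two squares in
  -- `bil`.
  have := bil x ((‖x‖ / ‖T x‖) • T x)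
  rw [inner_smul_left, RCLike.conj_to_real, real_inner_self_eq_norm_sq, norm_smul, norm_div,
    norm_norm, norm_norm, div_mul_cancel₀ _ hT0.ne'] at this
  have e : ‖x‖ / ‖T x‖ * ‖T x‖ ^ 2 = ‖x‖ * ‖T x‖ := by field_simp
  rw [e] at this
  have hx' : 0 < ‖x‖ := norm_pos_iff.2 hx
  nlinarith

/-- By symmetry `⟨x, Tx⟩ - ⟨u, Tu⟩ = ⟨x + u, T(x - u)⟩`, at most `‖T‖/2` for `u` within `1/4` of
`x`. The resulting `‖T‖ ≤ M + ‖T‖/2` is solved for `‖T‖`. -/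
lemma norm_le_two_mul_of_net {T : E →L[ℝ] E} (hT : (T : E →ₗ[ℝ] E).IsSymmetric) {N : Finset E}
    (h1 : ∀ u ∈ N, ‖u‖ = 1) (hN : ∀ x : E, ‖x‖ = 1 → ∃ u ∈ N, ‖x - u‖ ≤ 1 / 4) {M : ℝ}
    (hM : 0 ≤ M) (h : ∀ u ∈ N, |inner ℝ u (T u)| ≤ M) : ‖T‖ ≤ 2 * M := by
  have key : ‖T‖ ≤ M + ‖T‖ / 2 := by
    refine norm_le_of_abs_inner_self_le hT (by positivity) fun x hx => ?_
    obtain ⟨u, hu, hxu⟩ := hN x hx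
    have e : inner ℝ x (T x) = inner ℝ u (T u) + inner ℝ (x + u) (T (x - u)) := by
      have hs : inner ℝ x (T u) = inner ℝ u (T x) := by
        rw [← real_inner_comm]; exact hT u x
      simp only [map_sub, inner_add_left, inner_sub_right]
      linarith
    rw [e]
    refine (abs_add_le _ _).trans (add_le_add (h u hu) ?_)
    calc |inner ℝ (x + u) (T (x - u))| ≤ ‖x + u‖ * ‖T (x - u)‖ := abs_real_inner_le_norm _ _
      _ ≤ 2 * (‖T‖ * (1 / 4)) := by
        gcongr
        · refine (norm_add_le _ _).trans ?_
          rw [hx, h1 u hu]; norm_num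
        · exact (T.le_opNorm _).trans (by gcongr)
      _ = ‖T‖ / 2 := by ring
  linarith

lemma inner_map_self_ge_of_close {T : E →L[ℝ] E} (hT : (T : E →ₗ[ℝ] E).IsSymmetric) {x u : E}
    (hx : ‖x‖ = 1) (hu : ‖u‖ = 1) {ε : ℝ} (hxu : ‖x - u‖ ≤ ε) :
    inner ℝ u (T u) - 2 * ε * ‖T‖ ≤ inner ℝ x (T x) := by
  have e : inner ℝ x (T x) = inner ℝ u (T u) + inner ℝ (x + u) (T (x - u)) := by
    have hs : inner ℝ x (T u) = inner ℝ u (T x) := by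
      rw [← real_inner_comm]; exact hT u x
    simp only [map_sub, inner_add_left, inner_sub_right]
    linarith
  have : |inner ℝ (x + u) (T (x - u))| ≤ 2 * (‖T‖ * ε) := by
    refine (abs_real_inner_le_norm _ _).trans ?_
    gcongr
    · refine (norm_add_le _ _).trans ?_
      rw [hx, hu]; norm_num
    · exact (T.le_opNorm _).trans (by gcongr)
  have := (abs_le.1 this).1
  linarith

end Symmetric

/-! ### Sorted eigenbases and Courant–Fischer -/

section Spectral

variable {E : Type*} [NormedAddCommGroup E] [InnerProductSpace ℝ E]
  {n : ℕ} (b : OrthonormalBasis (Fin n) ℝ E) {lam : Fin n → ℝ} {T : E →ₗ[ℝ] E}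

/-- Dimension count: there are fewer linear conditions, one for each index outside `J`, than
dimensions of `U`. -/
lemma exists_mem_ne_zero_inner_eq_zero (U : Submodule ℝ E) [FiniteDimensional ℝ U] (J : Finset (Fin n))
    (h : n < Module.finrank ℝ U + J.card) :
    ∃ x ∈ U, x ≠ 0 ∧ ∀ j ∉ J, inner ℝ (b j) x = 0 := by
  let f : U →ₗ[ℝ] ({j // j ∉ J} → ℝ) := LinearMap.pi fun j => (innerₛₗ ℝ (b j.1)).comp U.subtype
  have hd : Module.finrank ℝ ({j // j ∉ J} → ℝ) < Module.finrank ℝ U := by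
    rw [Module.finrank_fintype_fun_eq_card, Fintype.card_subtype_compl, Fintype.card_fin,
      Fintype.card_coe]
    have := J.card_le_univ
    rw [Fintype.card_fin] at this
    omega
  obtain ⟨x, hx, hx0⟩ := (Submodule.ne_bot_iff _).1 (LinearMap.ker_ne_bot_of_finrank_lt (f := f) hd)
  refine ⟨x, x.2, by simpa using hx0, fun j hj => ?_⟩
  have := congrFun (LinearMap.mem_ker.1 hx) ⟨j, hj⟩
  simpa [f] using this

lemma OrthonormalBasis.inner_map_of_eigen (hb : ∀ i, T (b i) = lam i • b i) (x : E) (j : Fin n) :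
    inner ℝ (b j) (T x) = lam j * inner ℝ (b j) x := by
  conv_lhs => rw [← b.sum_repr x]
  rw [map_sum, inner_sum, Finset.sum_eq_single j]
  · rw [map_smul, hb, inner_smul_right, inner_smul_right, b.repr_apply_apply,
      real_inner_self_eq_norm_sq, b.norm_eq_one]; ring
  · intro i _ hij
    rw [map_smul, hb, inner_smul_right, inner_smul_right, b.inner_eq_zero hij.symm]; simp
  · simp

lemma OrthonormalBasis.norm_sq_eq_sum (x : E) : ‖x‖ ^ 2 = ∑ j, inner ℝ (b j) x ^ 2 := by
  rw [← real_inner_self_eq_norm_sq, ← b.sum_inner_mul_inner]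
  exact Finset.sum_congr rfl fun j _ => by rw [real_inner_comm]; ring

lemma OrthonormalBasis.inner_map_self_of_eigen (hb : ∀ i, T (b i) = lam i • b i) (x : E) :
    inner ℝ x (T x) = ∑ j, lam j * inner ℝ (b j) x ^ 2 := by
  rw [← b.sum_inner_mul_inner]
  refine Finset.sum_congr rfl fun j _ => ?_
  rw [b.inner_map_of_eigen hb, real_inner_comm]; ring

lemma OrthonormalBasis.isSymmetric_of_eigen (hb : ∀ i, T (b i) = lam i • b i) : T.IsSymmetric := by
  intro x y
  rw [← b.sum_inner_mul_inner, ← b.sum_inner_mul_inner]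
  refine Finset.sum_congr rfl fun j _ => ?_
  rw [b.inner_map_of_eigen hb, real_inner_comm, b.inner_map_of_eigen hb, real_inner_comm]
  ring

/-- One half of the Courant–Fischer principle. -/
lemma le_eigenvalue_of_le_inner (hlam : Antitone lam) (hb : ∀ i, T (b i) = lam i • b i)
    {U : Submodule ℝ E} [FiniteDimensional ℝ U] {s : ℝ} (hs : ∀ x ∈ U, s * ‖x‖ ^ 2 ≤ inner ℝ x (T x)) (i : Fin n)
    (hi : i.val < Module.finrank ℝ U) : s ≤ lam i := by
  obtain ⟨x, hxU, hx0, hx⟩ := exists_mem_ne_zero_inner_eq_zero b U (Finset.Ici i) (by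
    rw [Fin.card_Ici]; omega)
  have h1 := hs x hxU
  have h2 : inner ℝ x (T x) ≤ lam i * ‖x‖ ^ 2 := by
    rw [b.inner_map_self_of_eigen hb, b.norm_sq_eq_sum, Finset.mul_sum]
    refine Finset.sum_le_sum fun j _ => ?_
    by_cases hj : i ≤ j
    · exact mul_le_mul_of_nonneg_right (hlam hj) (sq_nonneg _)
    · rw [hx j (by simpa using hj)]; simp
  have : 0 < ‖x‖ ^ 2 := by have := norm_pos_iff.2 hx0; positivity
  exact le_of_mul_le_mul_right (h1.trans h2) this

/-- The other half of Courant–Fischer: `U` meets the span of the first `i + 1` eigenvectors, where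
the form is at least `lam i`. -/
lemma eigenvalue_le_of_inner_le (hlam : Antitone lam) (hb : ∀ i, T (b i) = lam i • b i)
    {U : Submodule ℝ E} [FiniteDimensional ℝ U] {s : ℝ} (hs : ∀ x ∈ U, inner ℝ x (T x) ≤ s * ‖x‖ ^ 2) (i : Fin n)
    (hi : n ≤ i.val + Module.finrank ℝ U) : lam i ≤ s := by
  obtain ⟨x, hxU, hx0, hx⟩ := exists_mem_ne_zero_inner_eq_zero b U (Finset.Iic i) (by
    rw [Fin.card_Iic]; omega)
  have h1 := hs x hxU
  have h2 : lam i * ‖x‖ ^ 2 ≤ inner ℝ x (T x) := by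
    rw [b.inner_map_self_of_eigen hb, b.norm_sq_eq_sum, Finset.mul_sum]
    refine Finset.sum_le_sum fun j _ => ?_
    by_cases hj : j ≤ i
    · exact mul_le_mul_of_nonneg_right (hlam hj) (sq_nonneg _)
    · rw [hx j (by simpa using hj)]; simp
  have : 0 < ‖x‖ ^ 2 := by have := norm_pos_iff.2 hx0; positivity
  exact le_of_mul_le_mul_right (h2.trans h1) this

lemma inner_eq_zero_of_mem_span {k : ℕ} {x : E} (hx : x ∈ Submodule.span ℝ (b '' {i | i.val < k}))
    {j : Fin n} (hj : k ≤ j.val) : inner ℝ (b j) x = 0 := by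
  induction hx using Submodule.span_induction with
  | mem x h =>
    obtain ⟨i, hi, rfl⟩ := h
    exact b.inner_eq_zero (by rintro rfl; exact absurd hi (not_lt.2 hj))
  | zero => simp
  | add x y _ _ hx hy => rw [inner_add_right, hx, hy, add_zero]
  | smul a x _ hx => rw [inner_smul_right, hx, mul_zero]

lemma finrank_span_image_lt {k : ℕ} (hk : k ≤ n) :
    Module.finrank ℝ (Submodule.span ℝ (b '' {i | i.val < k})) = k := by
  have hli : LinearIndependent ℝ fun i : {i : Fin n | i.val < k} => b i :=
    b.orthonormal.linearIndependent.comp _ Subtype.val_injective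
  rw [Set.image_eq_range, finrank_span_eq_card hli]
  have h := Fintype.card_subtype fun i : Fin n => i.val < k
  rw [Fin.card_filter_val_lt, min_eq_right hk] at h
  exact h

/-- If the range of `T` is contained in a `k`-dimensional subspace and the `k`-th eigenvalue of `T`
is at least `s > 0`, then `T ≥ s` on this subspace. -/
lemma le_inner_of_le_eigenvalue [FiniteDimensional ℝ E] (hlam : Antitone lam)
    (hb : ∀ i, T (b i) = lam i • b i)
    {V : Submodule ℝ E} (hV : ∀ x, T x ∈ V) {s : ℝ} (hs : 0 < s) (i : Fin n)
    (hi : i.val + 1 = Module.finrank ℝ V) (hsi : s ≤ lam i) {x : E} (hx : x ∈ V) :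
    s * ‖x‖ ^ 2 ≤ inner ℝ x (T x) := by
  -- Eigenvectors with nonzero eigenvalue lie in the range, hence in `V`; equality of dimensions
  -- makes the top eigenspace all of `V`.
  have hle : Submodule.span ℝ (b '' {j | j.val < i.val + 1}) ≤ V := by
    rw [Submodule.span_le]
    rintro _ ⟨j, hj, rfl⟩
    have hj' : s ≤ lam j := hsi.trans (hlam (by rw [Fin.le_def]; exact Nat.lt_succ_iff.1 hj))
    have h0 : lam j ≠ 0 := by linarith
    have := V.smul_mem (lam j)⁻¹ (hV (b j))
    rwa [hb, smul_smul, inv_mul_cancel₀ h0, one_smul] at this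
  have heq := Submodule.eq_of_le_of_finrank_eq hle
    ((finrank_span_image_lt b (by have := i.2; omega)).trans hi)
  rw [← heq] at hx
  rw [b.inner_map_self_of_eigen hb, b.norm_sq_eq_sum, Finset.mul_sum]
  refine Finset.sum_le_sum fun j _ => ?_
  by_cases hj : j ≤ i
  · exact mul_le_mul_of_nonneg_right (hsi.trans (hlam hj)) (sq_nonneg _)
  · rw [inner_eq_zero_of_mem_span b hx (j := j) (by rw [Fin.le_def] at hj; omega)]; simp

end Spectral

/-! ### Perturbation of the top eigenspace -/

section DavisKahan

variable {E : Type*} [NormedAddCommGroup E] [InnerProductSpace ℝ E] [FiniteDimensional ℝ E]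
  {n : ℕ} (b : OrthonormalBasis (Fin n) ℝ E) {lam : Fin n → ℝ} {T T₀ : E →ₗ[ℝ] E}
  {V W : Submodule ℝ E}

/-- A symmetric operator with range in `V` vanishes on `Vᗮ`. -/
lemma map_eq_map_starProjection (hT₀ : T₀.IsSymmetric) (hV : ∀ x, T₀ x ∈ V) (x : E) :
    T₀ x = T₀ (V.starProjection x) := by
  have h : T₀ (x - V.starProjection x) = 0 := by
    rw [← inner_self_eq_zero (𝕜 := ℝ), hT₀]
    exact Submodule.inner_left_of_mem_orthogonal (hV _)
      (Submodule.sub_starProjection_mem_orthogonal (K := V) x)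
  rw [map_sub, sub_eq_zero] at h
  exact h

/-- If `‖P_V y‖ ≤ ρ ‖y‖` on `Wᗮ` and `‖P_W z‖ ≤ ρ ‖z‖` on `Vᗮ`, then `‖P_V - P_W‖ ≤ ρ`. -/
lemma norm_starProjection_sub_le_of_orthogonal {ρ : ℝ} (hρ : 0 ≤ ρ)
    (h1 : ∀ y ∈ Wᗮ, ‖V.starProjection y‖ ≤ ρ * ‖y‖)
    (h2 : ∀ z ∈ Vᗮ, ‖W.starProjection z‖ ≤ ρ * ‖z‖) :
    ‖V.starProjection - W.starProjection‖ ≤ ρ := by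
  refine ContinuousLinearMap.opNorm_le_bound _ hρ fun x => ?_
  set y := W.starProjection x with hy
  set y' := x - y with hy'
  have hyW : y ∈ W := Submodule.starProjection_apply_mem W x
  have hy'W : y' ∈ Wᗮ := Submodule.sub_starProjection_mem_orthogonal x
  set z := y - V.starProjection y with hz
  have hzV : z ∈ Vᗮ := Submodule.sub_starProjection_mem_orthogonal y
  -- Duality: `‖z‖² = ⟨z, y⟩ = ⟨P_W z, y⟩`, so the hypothesis on `Vᗮ` bounds the component of `y ∈
  -- W` orthogonal to `V`.
  have hz2 : ‖z‖ ≤ ρ * ‖y‖ := by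
    have e1 : ‖z‖ ^ 2 = inner ℝ (W.starProjection z) y := by
      rw [← real_inner_self_eq_norm_sq]
      have h3 : inner ℝ z (V.starProjection y) = 0 :=
        Submodule.inner_left_of_mem_orthogonal (Submodule.starProjection_apply_mem V y) hzV
      have h4 : inner ℝ z z = inner ℝ z y := by
        conv_lhs => rw [hz, inner_sub_right]
        rw [← hz, h3, sub_zero]
      have h5 : inner ℝ (z - W.starProjection z) y = 0 :=
        Submodule.inner_left_of_mem_orthogonal hyW (Submodule.sub_starProjection_mem_orthogonal z)
      rw [inner_sub_left] at h5
      linarith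
    have e2 : ‖z‖ ^ 2 ≤ ρ * ‖z‖ * ‖y‖ := by
      rw [e1]
      exact (real_inner_le_norm _ _).trans (by gcongr; exact h2 z hzV)
    rcases (norm_nonneg z).eq_or_lt with h0 | h0
    · rw [← h0]; positivity
    · nlinarith
  have hx : (V.starProjection - W.starProjection) x = V.starProjection y' - z := by
    rw [_root_.sub_apply, hz, hy', map_sub]; simp [hy]
  -- Both `(P_V - P_W)x = P_V y' - z` and `x = y' + y` are orthogonal decompositions, so the two
  -- bounds add in squares without losing a constant.
  have n1 : ‖V.starProjection y' - z‖ ^ 2 = ‖V.starProjection y'‖ ^ 2 + ‖z‖ ^ 2 := by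
    have : inner ℝ (V.starProjection y') z = 0 :=
      Submodule.inner_right_of_mem_orthogonal (Submodule.starProjection_apply_mem V y') hzV
    rw [norm_sub_sq_real, this]; ring
  have n2 : ‖x‖ ^ 2 = ‖y'‖ ^ 2 + ‖y‖ ^ 2 := by
    have : inner ℝ y' y = 0 := Submodule.inner_left_of_mem_orthogonal hyW hy'W
    have e : x = y' + y := by simp [hy']
    conv_lhs => rw [e, norm_add_sq_real, this]
    ring
  rw [hx]
  refine abs_le_of_sq_le_sq' ?_ (by positivity) |>.2
  have a1 := pow_le_pow_left₀ (norm_nonneg _) (h1 y' hy'W) 2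
  have a2 := pow_le_pow_left₀ (norm_nonneg _) hz2 2
  rw [n1, mul_pow, n2]
  rw [mul_pow] at a1 a2
  linarith

/-- A Davis–Kahan bound: `T₀` has rank `k` with range `V` and is at least `s` there, `T` is within
`e` of `T₀`, and `W` is spanned by the top-`k` eigenvectors of `T`. -/
lemma norm_starProjection_sub_span_le (hlam : Antitone lam) (hb : ∀ i, T (b i) = lam i • b i)
    (hT₀ : T₀.IsSymmetric) (hV : ∀ x, T₀ x ∈ V) {s e : ℝ} (hs : 0 < s) (he : 0 ≤ e)
    (hes : 2 * e ≤ s) (hsV : ∀ x ∈ V, s * ‖x‖ ^ 2 ≤ inner ℝ x (T₀ x))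
    (hTe : ∀ x, ‖T x - T₀ x‖ ≤ e * ‖x‖) {k : ℕ} (hk : Module.finrank ℝ V = k) :
    ‖V.starProjection - (Submodule.span ℝ (b '' {i | i.val < k})).starProjection‖ ≤ 2 * e / s := by
  set W := Submodule.span ℝ (b '' {i | i.val < k}) with hW
  have hn : Module.finrank ℝ E = n := by
    rw [Module.finrank_eq_card_basis b.toBasis, Fintype.card_fin]
  have hbW : ∀ j : Fin n, j.val < k → b j ∈ W := fun j hj =>
    Submodule.subset_span ⟨j, hj, rfl⟩
  have hdiff : ∀ x, |inner ℝ x (T x) - inner ℝ x (T₀ x)| ≤ e * ‖x‖ ^ 2 := by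
    intro x
    rw [← inner_sub_right]
    refine (abs_real_inner_le_norm _ _).trans ?_
    have := mul_le_mul_of_nonneg_left (hTe x) (norm_nonneg x)
    linarith
  have hT₀0 : ∀ z ∈ Vᗮ, T₀ z = 0 := by
    intro z hz
    rw [map_eq_map_starProjection hT₀ hV, (Submodule.starProjection_apply_eq_zero_iff V).2 hz, map_zero]
  have hT₀nn : ∀ x, 0 ≤ inner ℝ x (T₀ x) := by
    intro x
    have e1 : inner ℝ x (T₀ x) = inner ℝ (V.starProjection x) (T₀ (V.starProjection x)) := by
      rw [map_eq_map_starProjection hT₀ hV x, ← hT₀,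
        map_eq_map_starProjection hT₀ hV x, hT₀]
    rw [e1]
    exact (by positivity : 0 ≤ s * ‖V.starProjection x‖ ^ 2).trans
      (hsV _ (Submodule.starProjection_apply_mem V x))
  -- Weyl-type bounds: testing on `V` puts the top `k` eigenvalues above `s - e`; testing on `Vᗮ`,
  -- together with `T₀ ≥ 0`, puts the others in `[-e, e]`.
  have hlow : ∀ i : Fin n, i.val < k → s - e ≤ lam i := fun i hi =>
    le_eigenvalue_of_le_inner b hlam hb (U := V) (fun x hx => by
      have := (abs_le.1 (hdiff x)).1
      have := hsV x hx
      linarith) i (hk ▸ hi)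
  have hup : ∀ i : Fin n, k ≤ i.val → |lam i| ≤ e := by
    intro i hi
    rw [abs_le]
    constructor
    · have h1 := (abs_le.1 (hdiff (b i))).1
      have h2 := hT₀nn (b i)
      rw [hb, inner_smul_right, real_inner_self_eq_norm_sq, b.norm_eq_one] at h1
      linarith
    · refine eigenvalue_le_of_inner_le b hlam hb (U := Vᗮ) (fun x hx => ?_) i ?_
      · have h1 := (abs_le.1 (hdiff x)).2
        rw [hT₀0 x hx, inner_zero_right] at h1
        linarith
      · have := V.finrank_add_finrank_orthogonal
        omega
  have hse : 0 < s - e := by linarith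
  refine norm_starProjection_sub_le_of_orthogonal (by positivity) ?_ ?_
  -- On `Wᗮ` the operator `T` has norm at most `e`, so `‖T₀ y‖ ≤ 2e‖y‖`; but `T₀` stretches `P_V y`
  -- by at least `s`.
  · intro y hy
    have hTy : ‖T y‖ ≤ e * ‖y‖ := by
      refine (abs_le_of_sq_le_sq' ?_ (by positivity)).2
      rw [mul_pow, b.norm_sq_eq_sum, b.norm_sq_eq_sum y, Finset.mul_sum]
      refine Finset.sum_le_sum fun j _ => ?_
      rw [b.inner_map_of_eigen hb, mul_pow]
      by_cases hj : k ≤ j.val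
      · have := hup j hj
        exact mul_le_mul_of_nonneg_right (sq_le_sq' (abs_le.1 this).1 (abs_le.1 this).2)
          (sq_nonneg _)
      · rw [Submodule.inner_right_of_mem_orthogonal (hbW j (not_le.1 hj)) hy]; simp
    have hT₀y : ‖T₀ y‖ ≤ 2 * e * ‖y‖ := by
      have : T₀ y = T y - (T y - T₀ y) := by abel
      rw [this]
      refine (norm_sub_le _ _).trans ?_
      linarith [hTe y]
    have h3 := hsV _ (Submodule.starProjection_apply_mem V y)
    rw [← map_eq_map_starProjection hT₀ hV y] at h3
    have h4 := h3.trans (real_inner_le_norm _ _)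
    rw [div_mul_eq_mul_div, le_div_iff₀ hs]
    rcases (norm_nonneg (V.starProjection y)).eq_or_lt with h0 | h0
    · rw [← h0]; rw [zero_mul]; positivity
    · have : s * ‖V.starProjection y‖ ≤ ‖T₀ y‖ := by nlinarith
      linarith
  -- On `Vᗮ`, `T₀` vanishes and `‖T z‖ ≤ e‖z‖`; but `T` stretches `P_W z` by at least `s - e ≥ s/2`.
  · intro z hz
    have h1 : (s - e) * ‖W.starProjection z‖ ≤ ‖T z‖ := by
      refine (abs_le_of_sq_le_sq' ?_ (norm_nonneg _)).2
      rw [mul_pow, b.norm_sq_eq_sum, b.norm_sq_eq_sum (T z), Finset.mul_sum]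
      refine Finset.sum_le_sum fun j _ => ?_
      rw [b.inner_map_of_eigen hb, mul_pow]
      by_cases hj : k ≤ j.val
      · rw [inner_eq_zero_of_mem_span b (Submodule.starProjection_apply_mem W z) hj]
        rw [zero_pow two_ne_zero, mul_zero]; positivity
      · have h5 : inner ℝ (b j) (W.starProjection z) = inner ℝ (b j) z := by
          have := Submodule.inner_right_of_mem_orthogonal (hbW j (not_le.1 hj))
            (Submodule.sub_starProjection_mem_orthogonal (K := W) z)
          rw [inner_sub_right] at this
          linarith
        rw [h5]
        have := hlow j (not_le.1 hj)
        gcongr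
    have h2 := hTe z
    rw [hT₀0 z hz, sub_zero] at h2
    rw [div_mul_eq_mul_div, le_div_iff₀ hs]
    have h6 : s * ‖W.starProjection z‖ ≤ 2 * ((s - e) * ‖W.starProjection z‖) := by
      have := norm_nonneg (W.starProjection z)
      nlinarith
    linarith

end DavisKahan

/-! ### The matrix eigenvalue in terms of quadratic forms -/

section KthEigenvalue

variable {d : ℕ}

/-- Puts `kthEigenvalue` in the form used by the spectral lemmas; positions count from zero, whence
`i + 1 = k`. -/
lemma exists_basis_kthEigenvalue {A : Matrix (Fin d) (Fin d) ℝ} (hA : A.IsHermitian) {k : ℕ}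
    (hk : 1 ≤ k) (hkd : k ≤ Fintype.card (Fin d)) :
    ∃ (b : OrthonormalBasis (Fin (Fintype.card (Fin d))) ℝ (Vec d))
      (lam : Fin (Fintype.card (Fin d)) → ℝ) (i : Fin (Fintype.card (Fin d))), Antitone lam ∧
      (∀ i, Matrix.toEuclideanLin A (b i) = lam i • b i) ∧ i.val + 1 = k ∧
      kthEigenvalue A k = lam i := by
  refine ⟨(Matrix.isSymmetric_toEuclideanLin_iff.mpr hA).eigenvectorBasis finrank_euclideanSpace,
    hA.eigenvalues₀, ⟨k - 1, by omega⟩, hA.eigenvalues₀_antitone, fun i => ?_, by simp; omega, ?_⟩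
  · exact (Matrix.isSymmetric_toEuclideanLin_iff.mpr hA).apply_eigenvectorBasis _ i
  · rw [kthEigenvalue, dif_pos ⟨hA, hk, hkd⟩]

lemma le_inner_of_le_kthEigenvalue {A : Matrix (Fin d) (Fin d) ℝ} (hA : A.IsHermitian)
    {V : Submodule ℝ (Vec d)} (hV : ∀ x, Matrix.toEuclideanLin A x ∈ V) {k : ℕ} (hk : 1 ≤ k)
    (hkV : Module.finrank ℝ V = k) {s : ℝ} (hs : 0 < s) (h : s ≤ kthEigenvalue A k)
    {x : Vec d} (hx : x ∈ V) : s * ‖x‖ ^ 2 ≤ inner ℝ x (Matrix.toEuclideanLin A x) := by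
  have hkd : k ≤ Fintype.card (Fin d) := by
    have := V.finrank_le
    rwa [hkV, finrank_euclideanSpace] at this
  obtain ⟨b, lam, i, hlam, hb, hi, he⟩ := exists_basis_kthEigenvalue hA hk hkd
  exact le_inner_of_le_eigenvalue b hlam hb hV hs i (hi.trans hkV.symm) (he ▸ h) hx

lemma le_kthEigenvalue_of_le_inner {A : Matrix (Fin d) (Fin d) ℝ} (hA : A.IsHermitian)
    {V : Submodule ℝ (Vec d)} {k : ℕ} (hk : 1 ≤ k) (hkV : Module.finrank ℝ V = k) {s : ℝ}
    (h : ∀ x ∈ V, s * ‖x‖ ^ 2 ≤ inner ℝ x (Matrix.toEuclideanLin A x)) :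
    s ≤ kthEigenvalue A k := by
  have hkd : k ≤ Fintype.card (Fin d) := by
    have := V.finrank_le
    rwa [hkV, finrank_euclideanSpace] at this
  obtain ⟨b, lam, i, hlam, hb, hi, he⟩ := exists_basis_kthEigenvalue hA hk hkd
  rw [he]
  exact le_eigenvalue_of_le_inner b hlam hb h i (by omega)

end KthEigenvalue

/-! ### Weighted sums of rank-one matrices -/

section Outer

variable {d : ℕ}

lemma inner_eq_sum (x y : Vec d) : inner ℝ x y = ∑ a, x a * y a := by
  rw [PiLp.inner_apply]
  exact Finset.sum_congr rfl fun a _ => by simp [mul_comm]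

lemma toEuclideanLin_outer_apply (x y z : Vec d) :
    Matrix.toEuclideanLin (outer x y) z = (inner ℝ y z : ℝ) • x := by
  ext a
  simp only [Matrix.toLpLin_apply, Matrix.mulVec, dotProduct, outer, Matrix.of_apply,
    PiLp.smul_apply, smul_eq_mul, inner_eq_sum, Finset.sum_mul]
  exact Finset.sum_congr rfl fun _ _ => by ring

lemma inner_toEuclideanLin_outer (x y z u : Vec d) :
    inner ℝ u (Matrix.toEuclideanLin (outer x y) z) = inner ℝ u x * inner ℝ y z := by
  rw [toEuclideanLin_outer_apply, inner_smul_right, mul_comm]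

variable {n : ℕ} (w : Fin n → ℝ) (v : Fin n → Vec d)

lemma sum_smul_outer_isHermitian : (∑ i, w i • outer (v i) (v i)).IsHermitian := by
  ext a b
  simp [Matrix.sum_apply, outer, mul_comm]

lemma inner_sum_smul_outer (u z : Vec d) :
    inner ℝ u (Matrix.toEuclideanLin (∑ i, w i • outer (v i) (v i)) z) =
      ∑ i, w i * (inner ℝ u (v i) * inner ℝ (v i) z) := by
  rw [map_sum, LinearMap.sum_apply, inner_sum]
  refine Finset.sum_congr rfl fun i _ => ?_
  rw [map_smul, LinearMap.smul_apply, inner_smul_right, inner_toEuclideanLin_outer]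

lemma sum_smul_outer_mem {V : Submodule ℝ (Vec d)} (hv : ∀ i, v i ∈ V) (x : Vec d) :
    Matrix.toEuclideanLin (∑ i, w i • outer (v i) (v i)) x ∈ V := by
  rw [map_sum, LinearMap.sum_apply]
  refine V.sum_mem fun i _ => ?_
  rw [map_smul, LinearMap.smul_apply, toEuclideanLin_outer_apply]
  exact V.smul_mem _ (V.smul_mem _ (hv i))

end Outer

/-! ### Compression to a subspace -/

section Compression

variable {E : Type*} [NormedAddCommGroup E] [InnerProductSpace ℝ E] [FiniteDimensional ℝ E]

/-- The compression of an operator to a subspace. -/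
noncomputable def compression (T : E →ₗ[ℝ] E) (V : Submodule ℝ E) : V →L[ℝ] V :=
  V.orthogonalProjectionOnto ∘L (LinearMap.toContinuousLinearMap T) ∘L V.subtypeL

lemma inner_compression (T : E →ₗ[ℝ] E) (V : Submodule ℝ E) (x y : V) :
    inner ℝ x (compression T V y) = inner ℝ (x : E) (T y) := by
  exact V.inner_orthogonalProjectionOnto_eq_of_mem_left x (T y)

lemma compression_isSymmetric {T : E →ₗ[ℝ] E} (hT : T.IsSymmetric) (V : Submodule ℝ E) :
    (compression T V : V →ₗ[ℝ] V).IsSymmetric := by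
  intro x y
  change inner ℝ (compression T V x) y = inner ℝ x (compression T V y)
  rw [inner_compression, real_inner_comm, inner_compression, real_inner_comm, hT]

lemma abs_inner_le_of_norm_compression_le {T : E →ₗ[ℝ] E} {V : Submodule ℝ E} {M : ℝ}
    (h : ‖compression T V‖ ≤ M) {x : E} (hx : x ∈ V) : |inner ℝ x (T x)| ≤ M * ‖x‖ ^ 2 := by
  have := abs_real_inner_le_norm (⟨x, hx⟩ : V) (compression T V ⟨x, hx⟩)
  rw [inner_compression] at this
  refine this.trans ?_
  have h2 := ((compression T V).le_opNorm ⟨x, hx⟩).trans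
    (mul_le_mul_of_nonneg_right h (norm_nonneg _))
  simp only [Submodule.coe_norm] at h2 ⊢
  nlinarith [norm_nonneg x]

end Compression

/-! ### Second moments and lower exponential moments -/

section SecondMoment

variable {Ω : Type*} [MeasurableSpace Ω] {P : Measure Ω} {d : ℕ} {Y : Ω → Vec d} {b : ℝ}

lemma inner_single_one (a : Fin d) (x : Vec d) : inner ℝ (EuclideanSpace.single a (1 : ℝ)) x = x a := by
  rw [EuclideanSpace.inner_single_left]; simp

lemma HasSubGaussianConstVec.integrable (h : HasSubGaussianConstVec Y b P) : Integrable Y P := by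
  refine Integrable.of_eval_piLp fun a => ?_
  have := (h (EuclideanSpace.single a 1) (by simp)).2.1
  simpa only [inner_single_one] using this

lemma HasSubGaussianConstVec.integral_inner_eq_zero (h : HasSubGaussianConstVec Y b P)
    (h0 : ∫ ω, Y ω ∂P = 0) (u : Vec d) : ∫ ω, inner ℝ u (Y ω) ∂P = 0 := by
  rw [integral_inner h.integrable, h0, inner_zero_right]

lemma HasSubGaussianConst.memLp_two {X : Ω → ℝ} (h : HasSubGaussianConst X b P)
    (h0 : ∫ ω, X ω ∂P = 0) : MemLp X 2 P := by
  refine ⟨h.2.1.aestronglyMeasurable, ?_⟩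
  have := h.2.2 2 (by norm_num)
  simp only [h0, sub_zero] at this
  rw [show ENNReal.ofReal 2 = 2 by simp] at this
  exact this.trans_lt ENNReal.ofReal_lt_top

lemma inner_secondMoment (hY : ∀ a b, Integrable (fun ω => Y ω a * Y ω b) P) (x y : Vec d) :
    inner ℝ y (Matrix.toEuclideanLin (secondMoment Y P) x) =
      ∫ ω, inner ℝ y (Y ω) * inner ℝ (Y ω) x ∂P := by
  have h1 : ∀ ω, inner ℝ y (Y ω) * inner ℝ (Y ω) x =
      ∑ a, ∑ c, (y a * x c) * (Y ω a * Y ω c) := by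
    intro ω
    rw [inner_eq_sum, inner_eq_sum, Finset.sum_mul_sum]
    exact Finset.sum_congr rfl fun a _ => Finset.sum_congr rfl fun c _ => by ring
  simp_rw [h1]
  rw [integral_finsetSum _ fun a _ => integrable_finsetSum _ fun c _ => (hY a c).const_mul _,
    inner_eq_sum]
  refine Finset.sum_congr rfl fun a _ => ?_
  rw [integral_finsetSum _ fun c _ => (hY a c).const_mul _]
  simp only [Matrix.toLpLin_apply, Matrix.mulVec, dotProduct, secondMoment, Matrix.of_apply,
    Finset.mul_sum, integral_const_mul]
  exact Finset.sum_congr rfl fun c _ => by ring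

/-- The second moment matrix has range in the `k`-dimensional `V`, so its `k`-th eigenvalue bounds
its form from below on all of `V`. -/
lemma le_integral_inner_sq (hsg : HasSubGaussianConstVec Y b P) (h0 : ∫ ω, Y ω ∂P = 0)
    {V : Submodule ℝ (Vec d)} (hV : ∀ᵐ ω ∂P, Y ω ∈ V) {k : ℕ} (hk : 1 ≤ k)
    (hkV : Module.finrank ℝ V = k) {s : ℝ} (hs : 0 < s) (h : s ≤ kthEigenvalue (secondMoment Y P) k)
    {u : Vec d} (hu : u ∈ V) (hu1 : ‖u‖ = 1) : s ≤ ∫ ω, inner ℝ u (Y ω) ^ 2 ∂P := by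
  have hY : ∀ a c, Integrable (fun ω => Y ω a * Y ω c) P := by
    have hm : ∀ a, MemLp (fun ω => Y ω a) 2 P := fun a => by
      have := (hsg (EuclideanSpace.single a 1) (by simp)).memLp_two
        (hsg.integral_inner_eq_zero h0 _)
      simpa only [inner_single_one] using this
    exact fun a c => (hm a).integrable_mul (hm c)
  have hH : (secondMoment Y P).IsHermitian := by
    ext a c
    simp [secondMoment, mul_comm]
  have hmem : ∀ x, Matrix.toEuclideanLin (secondMoment Y P) x ∈ V := by
    intro x
    rw [← V.orthogonal_orthogonal, Submodule.mem_orthogonal]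
    intro y hy
    rw [inner_secondMoment hY]
    refine integral_eq_zero_of_ae ?_
    filter_upwards [hV] with ω hω
    rw [Submodule.inner_left_of_mem_orthogonal hω hy, zero_mul]; rfl
  have := le_inner_of_le_kthEigenvalue hH hmem hk hkV hs h hu
  rw [inner_secondMoment hY, hu1, one_pow, mul_one] at this
  refine this.trans (le_of_eq (integral_congr_ae (ae_of_all _ fun ω => ?_)))
  simp only [real_inner_comm u (Y ω)]; ring

/-- `(1 + x + x²/2)(1 - x + x²/2) = 1 + x⁴/4 ≥ 1`, and the first factor is at most `e^x`. -/
lemma Real.exp_neg_le_quadratic {x : ℝ} (hx : 0 ≤ x) : Real.exp (-x) ≤ 1 - x + x ^ 2 / 2 := by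
  have h := Real.quadratic_le_exp_of_nonneg hx
  have h1 : (0 : ℝ) < 1 - x + x ^ 2 / 2 := by nlinarith [sq_nonneg (x - 1)]
  rw [Real.exp_neg, inv_le_comm₀ (Real.exp_pos _) h1]
  refine le_trans ?_ h
  rw [inv_le_iff_one_le_mul₀ h1]
  nlinarith [pow_nonneg hx 4]

/-- Since `-cX²` is bounded above, a second-order expansion suffices for every `c ≥ 0`; the error
needs only the fourth moment, at most `16b⁴`. -/
lemma HasSubGaussianConst.lintegral_exp_neg_sq_le [IsProbabilityMeasure P] {X : Ω → ℝ}
    (h : HasSubGaussianConst X b P)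
    (h0 : ∫ ω, X ω ∂P = 0) {s : ℝ} (hs : s ≤ ∫ ω, X ω ^ 2 ∂P) {c : ℝ} (hc : 0 ≤ c) :
    ∫⁻ ω, ENNReal.ofReal (Real.exp (-(c * X ω ^ 2))) ∂P ≤
      ENNReal.ofReal (Real.exp (-(c * s) + 8 * c ^ 2 * b ^ 4)) := by
  have hX : AEMeasurable X P := h.2.1.aemeasurable
  have i2 : Integrable (fun ω => X ω ^ 2) P := (h.memLp_two h0).integrable_sq
  have h4 := h.lintegral_pow_le h0 (q := 2) (by norm_num)
  have e4 : ∀ ω, 0 ≤ X ω ^ (2 * 2) := fun ω => (even_two_mul 2).pow_nonneg _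
  have i4 : Integrable (fun ω => X ω ^ (2 * 2)) P :=
    ⟨by fun_prop, (hasFiniteIntegral_iff_ofReal (ae_of_all _ e4)).2
      (h4.trans_lt ENNReal.ofReal_lt_top)⟩
  have v4 : ∫ ω, X ω ^ (2 * 2) ∂P ≤ 16 * b ^ 4 := by
    rw [integral_eq_lintegral_of_nonneg_ae (ae_of_all _ e4) (by fun_prop)]
    refine (ENNReal.toReal_le_of_le_ofReal (by positivity) h4).trans (le_of_eq ?_)
    push_cast; ring
  have hle : ∀ ω, Real.exp (-(c * X ω ^ 2)) ≤ 1 - c * X ω ^ 2 + c ^ 2 / 2 * X ω ^ (2 * 2) := by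
    intro ω
    refine (Real.exp_neg_le_quadratic (x := c * X ω ^ 2) (by positivity)).trans (le_of_eq ?_)
    ring
  have hint : Integrable (fun ω => 1 - c * X ω ^ 2 + c ^ 2 / 2 * X ω ^ (2 * 2)) P :=
    ((integrable_const 1).sub (i2.const_mul c)).add (i4.const_mul _)
  refine (lintegral_mono fun ω => ENNReal.ofReal_le_ofReal (hle ω)).trans ?_
  rw [← ofReal_integral_eq_lintegral_ofReal hint
    (ae_of_all _ fun ω => (Real.exp_pos _).le.trans (hle ω))]
  apply ENNReal.ofReal_le_ofReal
  have hval : ∫ ω, (1 - c * X ω ^ 2 + c ^ 2 / 2 * X ω ^ (2 * 2)) ∂P =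
      1 - c * ∫ ω, X ω ^ 2 ∂P + c ^ 2 / 2 * ∫ ω, X ω ^ (2 * 2) ∂P := by
    rw [integral_add (f := fun ω => 1 - c * X ω ^ 2)
      ((integrable_const 1).sub (i2.const_mul c)) (i4.const_mul _),
      integral_sub (integrable_const 1) (i2.const_mul c), integral_const_mul, integral_const_mul,
      integral_const]
    simp
  rw [hval]
  refine le_trans ?_ (Real.add_one_le_exp _)
  have a1 := mul_le_mul_of_nonneg_left hs hc
  have a2 := mul_le_mul_of_nonneg_left v4 (by positivity : 0 ≤ c ^ 2 / 2)
  linarith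

end SecondMoment

/-! ### Concentration of the weighted second moments of the means -/

section Means

lemma nine_le_exp_three : (9 : ℝ) ≤ Real.exp 3 := by
  have h3 : Real.exp 3 = Real.exp 1 ^ 3 := by rw [← Real.exp_nat_mul]; norm_num
  have h4 := Real.exp_one_gt_d9
  rw [h3]
  calc (9 : ℝ) ≤ (2.7 : ℝ) ^ 3 := by norm_num
    _ ≤ _ := by gcongr; linarith

/-- Closes every union bound over a net: rate `g` pays for the `G^k` points, and the spare rate `6`
leaves `δ⁶ ≤ δ/32`, as `δ < 1/2`. -/
lemma pow_mul_exp_neg_le {k : ℕ} {G g δ a : ℝ} (hG : 0 ≤ G) (hg : 0 ≤ g) (hGg : G ≤ Real.exp g)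
    (hδ : 0 < δ) (hδ2 : δ < 1 / 2) (ha : g + 6 ≤ a) :
    G ^ k * Real.exp (-(a * (k + Real.log (1 / δ)))) ≤ δ / 32 := by
  have hL : 0 ≤ Real.log (1 / δ) := Real.log_nonneg (by rw [le_div_iff₀ hδ]; linarith)
  set L := Real.log (1 / δ) with hLdef
  have h1 : G ^ k ≤ Real.exp (k * g) := by
    rw [Real.exp_nat_mul]; gcongr
  have h2 : Real.exp (-(6 * L)) = δ ^ 6 := by
    rw [hLdef, one_div, Real.log_inv]
    rw [show -(6 * -Real.log δ) = (6 : ℕ) * Real.log δ by push_cast; ring, Real.exp_nat_mul,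
      Real.exp_log hδ]
  have h3 : δ ^ 6 ≤ δ / 32 := by
    have : δ ^ 5 ≤ (1 / 2) ^ 5 := by gcongr
    calc δ ^ 6 = δ * δ ^ 5 := by ring
      _ ≤ δ * (1 / 2) ^ 5 := by gcongr
      _ = δ / 32 := by ring
  refine le_trans ?_ h3
  rw [← h2]
  calc G ^ k * Real.exp (-(a * (k + L))) ≤ Real.exp (k * g) * Real.exp (-(a * (k + L))) := by gcongr
    _ = Real.exp (k * g - a * (k + L)) := by rw [← Real.exp_add]; ring_nf
    _ ≤ Real.exp (-(6 * L)) := by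
      apply Real.exp_le_exp.2
      have hk : (0 : ℝ) ≤ k := Nat.cast_nonneg k
      have : (g + 6) * (k + L) ≤ a * (k + L) := by gcongr
      nlinarith [mul_nonneg hg hL]

variable {Ω : Type*} [MeasurableSpace Ω] {P : Measure Ω} {n d k : ℕ}
  {M : Fin n → Ω → Vec d} {Γ : Submodule ℝ (Vec d)} {K σ : ℝ} {w : Fin n → ℝ}

lemma MeansAssumption.lintegral_exp_sum (h : MeansAssumption P M Γ k K σ) (u : Vec d)
    (c : Fin n → ℝ) :
    ∫⁻ ω, ENNReal.ofReal (Real.exp (∑ i, c i * inner ℝ u (M i ω) ^ 2)) ∂P =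
      ∏ i, ∫⁻ ω, ENNReal.ofReal (Real.exp (c i * inner ℝ u (M i ω) ^ 2)) ∂P := by
  have hm := h.measurable
  rw [← lintegral_prod_eq_prod_lintegral_of_indepFun (μ := P) Finset.univ
    (fun i ω => ENNReal.ofReal (Real.exp (c i * inner ℝ u (M i ω) ^ 2)))
    (h.indep.comp (fun i x => ENNReal.ofReal (Real.exp (c i * inner ℝ u x ^ 2)))
      fun i => by fun_prop) (fun i => by fun_prop)]
  refine lintegral_congr fun ω => ?_
  rw [Real.exp_sum, ENNReal.ofReal_prod_of_nonneg fun _ _ => (Real.exp_pos _).le]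

lemma prod_ofReal_exp (f : Fin n → ℝ) :
    ∏ i, ENNReal.ofReal (Real.exp (f i)) = ENNReal.ofReal (Real.exp (∑ i, f i)) := by
  rw [Real.exp_sum, ENNReal.ofReal_prod_of_nonneg fun _ _ => (Real.exp_pos _).le]

/-- Chernoff with the largest tilt `l` for which the weights still satisfy `12 l w_i (Kσ)² ≤ 1`. The
log-moment is then `R`, and the threshold corresponds to `10R`. -/
lemma MeansAssumption.measure_upper_le [IsProbabilityMeasure P]
    (h : MeansAssumption P M Γ k K σ) (hK : 0 < K) (hσ : 0 < σ)
    (hw0 : ∀ i, 0 ≤ w i) (hw1 : ∑ i, w i = 1) {R : ℝ} (hR : 0 < R) (hwR : ∀ i, w i ≤ 1 / R)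
    {u : Vec d} (hu : ‖u‖ = 1) :
    P {ω | 120 * K ^ 2 * σ ^ 2 ≤ ∑ i, w i * inner ℝ u (M i ω) ^ 2} ≤
      ENNReal.ofReal (Real.exp (-(9 * R))) := by
  have hm := h.measurable
  have hl : 0 < R / (12 * K ^ 2 * σ ^ 2) := by positivity
  set l := R / (12 * K ^ 2 * σ ^ 2) with hldef
  have hlR : l * (12 * K ^ 2 * σ ^ 2) = R := div_mul_cancel₀ _ (by positivity)
  have hb : ∫⁻ ω, ENNReal.ofReal (Real.exp (∑ i, (l * w i) * inner ℝ u (M i ω) ^ 2)) ∂P ≤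
      ENNReal.ofReal (Real.exp R) := by
    rw [h.lintegral_exp_sum]
    calc _ ≤ ∏ i, ENNReal.ofReal (Real.exp (12 * (l * w i) * (K * σ) ^ 2)) := by
          refine Finset.prod_le_prod' fun i _ => ?_
          refine (h.subGaussian i u hu).lintegral_exp_sq_le
            ((h.subGaussian i).integral_inner_eq_zero (h.mean_zero i) u)
            (mul_nonneg hl.le (hw0 i)) ?_
          calc 12 * (l * w i) * (K * σ) ^ 2 = l * (12 * K ^ 2 * σ ^ 2) * w i := by ring
            _ ≤ R * (1 / R) := by rw [hlR]; gcongr; exact hwR i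
            _ = 1 := by field_simp
      _ = _ := by
          rw [prod_ofReal_exp]
          congr 2
          calc ∑ i, 12 * (l * w i) * (K * σ) ^ 2 = ∑ i, l * (12 * K ^ 2 * σ ^ 2) * w i :=
                Finset.sum_congr rfl fun i _ => by ring
            _ = R := by rw [← Finset.mul_sum, hw1, hlR, mul_one]
  have := measure_le_of_lintegral_exp_le (t := 10 * R) (by fun_prop) hb
  rw [show -(9 * R) = R - 10 * R by ring]
  refine (measure_mono fun ω hω => ?_).trans this
  simp only [Set.mem_ofPred_eq, mul_assoc] at hω ⊢
  rw [← Finset.mul_sum]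
  calc 10 * R = l * (120 * (K ^ 2 * σ ^ 2)) := by rw [← hlR]; ring
    _ ≤ _ := by gcongr

/-- Chernoff with negative tilt. The gap between mean and threshold gains `lσ²/4`; this `l` makes
the second-order loss `lσ²/8`, leaving `lσ²/8 = Q/(512K⁴)`. -/
lemma MeansAssumption.measure_lower_le [IsProbabilityMeasure P]
    (h : MeansAssumption P M Γ k K σ) (hk : 1 ≤ k)
    (hK : 0 < K) (hσ : 0 < σ)
    (hw0 : ∀ i, 0 ≤ w i) (hw1 : ∑ i, w i = 1) {Q : ℝ} (hQ : 0 < Q) (hwQ : ∀ i, w i ≤ 1 / Q)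
    {u : Vec d} (huΓ : u ∈ Γ) (hu : ‖u‖ = 1) :
    P {ω | ∑ i, w i * inner ℝ u (M i ω) ^ 2 ≤ 3 / 4 * σ ^ 2} ≤
      ENNReal.ofReal (Real.exp (-(Q / (512 * K ^ 4)))) := by
  have hm := h.measurable
  set l := Q / (64 * K ^ 4 * σ ^ 2) with hldef
  have hl : 0 < l := by positivity
  set B := -(l * σ ^ 2) + 8 * l ^ 2 * (K * σ) ^ 4 / Q with hB
  have hb : ∫⁻ ω, ENNReal.ofReal (Real.exp (∑ i, (-(l * w i)) * inner ℝ u (M i ω) ^ 2)) ∂P ≤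
      ENNReal.ofReal (Real.exp B) := by
    rw [h.lintegral_exp_sum]
    calc _ ≤ ∏ i, ENNReal.ofReal (Real.exp (-((l * w i) * σ ^ 2) +
            8 * (l * w i) ^ 2 * (K * σ) ^ 4)) := by
          refine Finset.prod_le_prod' fun i _ => ?_
          simp only [neg_mul]
          exact (h.subGaussian i u hu).lintegral_exp_neg_sq_le
            ((h.subGaussian i).integral_inner_eq_zero (h.mean_zero i) u)
            (le_integral_inner_sq (h.subGaussian i) (h.mean_zero i) (h.supported i) hk
              h.finrank_eq (by positivity) (h.eigenvalue_ge i) huΓ hu) (mul_nonneg hl.le (hw0 i))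
      _ ≤ _ := by
          rw [prod_ofReal_exp]
          refine ENNReal.ofReal_le_ofReal (Real.exp_le_exp.2 ?_)
          calc ∑ i, (-((l * w i) * σ ^ 2) + 8 * (l * w i) ^ 2 * (K * σ) ^ 4) ≤
              ∑ i, w i * B := by
                refine Finset.sum_le_sum fun i _ => ?_
                have h1 : w i ^ 2 ≤ w i * (1 / Q) := by
                  rw [sq]; exact mul_le_mul_of_nonneg_left (hwQ i) (hw0 i)
                have h2 := mul_le_mul_of_nonneg_left h1
                  (by positivity : 0 ≤ 8 * l ^ 2 * (K * σ) ^ 4)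
                rw [hB]
                calc _ = -(l * w i * σ ^ 2) + 8 * l ^ 2 * (K * σ) ^ 4 * w i ^ 2 := by ring
                  _ ≤ -(l * w i * σ ^ 2) + 8 * l ^ 2 * (K * σ) ^ 4 * (w i * (1 / Q)) := by gcongr
                  _ = _ := by ring
            _ = B := by rw [← Finset.sum_mul, hw1, one_mul]
  have := measure_le_of_lintegral_exp_le (t := -(l * (3 / 4 * σ ^ 2))) (by fun_prop) hb
  have e : -(Q / (512 * K ^ 4)) = B - -(l * (3 / 4 * σ ^ 2)) := by
    rw [hB, hldef]; field_simp; ring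
  rw [e]
  refine (measure_mono fun ω hω => ?_).trans this
  simp only [Set.mem_ofPred_eq, neg_mul, mul_assoc, Finset.sum_neg_distrib] at hω ⊢
  rw [← Finset.mul_sum]
  exact neg_le_neg (mul_le_mul_of_nonneg_left hω hl.le)

/-- The quadratic form of the weighted second moment matrix is controlled by a net of `Γ`. -/
lemma norm_compression_sum_outer_le {v : Fin n → Vec d} (hw0 : ∀ i, 0 ≤ w i) {N : Finset Γ}
    (h1 : ∀ u ∈ N, ‖u‖ = 1) (hN : ∀ x : Γ, ‖x‖ = 1 → ∃ u ∈ N, ‖x - u‖ ≤ 1 / 4) {B : ℝ}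
    (hB : 0 ≤ B) (h : ∀ u ∈ N, ∑ i, w i * inner ℝ (u : Vec d) (v i) ^ 2 ≤ B) :
    ‖compression (Matrix.toEuclideanLin (∑ i, w i • outer (v i) (v i))) Γ‖ ≤ 2 * B := by
  refine norm_le_two_mul_of_net (compression_isSymmetric
    (Matrix.isSymmetric_toEuclideanLin_iff.mpr (sum_smul_outer_isHermitian w v)) Γ) h1 hN hB
    fun u hu => ?_
  rw [inner_compression, inner_sum_smul_outer]
  have e : ∑ i, w i * (inner ℝ (u : Vec d) (v i) * inner ℝ (v i) (u : Vec d)) =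
      ∑ i, w i * inner ℝ (u : Vec d) (v i) ^ 2 :=
    Finset.sum_congr rfl fun i _ => by rw [real_inner_comm (u : Vec d) (v i)]; ring
  rw [e, abs_of_nonneg (Finset.sum_nonneg fun i _ => mul_nonneg (hw0 i) (sq_nonneg _))]
  exact h u hu

lemma inner_sum_smul_outer_self (v : Fin n → Vec d) (u : Vec d) :
    inner ℝ u (Matrix.toEuclideanLin (∑ i, w i • outer (v i) (v i)) u) =
      ∑ i, w i * inner ℝ u (v i) ^ 2 := by
  rw [inner_sum_smul_outer]
  exact Finset.sum_congr rfl fun i _ => by rw [real_inner_comm u (v i)]; ring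

/-- Since the `v i` lie in `Γ`, only the projection of `u` to `Γ` matters. A net of dimension `k`
rather than `d` thus suffices, as the weights are controlled only through `k + log(1/δ)`. -/
lemma sum_inner_sq_le_of_net {v : Fin n → Vec d} (hv : ∀ i, v i ∈ Γ) (hw0 : ∀ i, 0 ≤ w i)
    {N : Finset Γ}
    (h1 : ∀ u ∈ N, ‖u‖ = 1) (hN : ∀ x : Γ, ‖x‖ = 1 → ∃ u ∈ N, ‖x - u‖ ≤ 1 / 4) {B : ℝ}
    (hB : 0 ≤ B) (h : ∀ u ∈ N, ∑ i, w i * inner ℝ (u : Vec d) (v i) ^ 2 ≤ B) {u : Vec d}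
    (hu : ‖u‖ = 1) : ∑ i, w i * inner ℝ u (v i) ^ 2 ≤ 2 * B := by
  have hp : ∀ i, inner ℝ u (v i) = inner ℝ (Γ.starProjection u) (v i) := by
    intro i
    have := Submodule.inner_left_of_mem_orthogonal (hv i)
      (Submodule.sub_starProjection_mem_orthogonal (K := Γ) u)
    rw [inner_sub_left] at this
    linarith
  simp_rw [hp]
  rw [← inner_sum_smul_outer_self]
  refine (le_abs_self _).trans ((abs_inner_le_of_norm_compression_le
    (norm_compression_sum_outer_le hw0 h1 hN hB h) (Γ.starProjection_apply_mem u)).trans ?_)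
  have h2 : ‖Γ.starProjection u‖ ≤ 1 := hu ▸ Γ.norm_starProjection_apply_le u
  have h3 : ‖Γ.starProjection u‖ ^ 2 ≤ 1 := pow_le_one₀ (norm_nonneg _) h2
  nlinarith

/-- The coarse net bounds the compressed operator by `2B`; moving to the nearest point of the fine
net then costs at most `2ε · 2B ≤ σ²/4`. -/
lemma half_sq_le_kthEigenvalue_of_nets {v : Fin n → Vec d} (hk : 1 ≤ k)
    (hΓ : Module.finrank ℝ Γ = k) (hw0 : ∀ i, 0 ≤ w i) {N : Finset Γ}
    (h1 : ∀ u ∈ N, ‖u‖ = 1) (hN : ∀ x : Γ, ‖x‖ = 1 → ∃ u ∈ N, ‖x - u‖ ≤ 1 / 4) {B : ℝ}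
    (hB : 0 ≤ B) (h : ∀ u ∈ N, ∑ i, w i * inner ℝ (u : Vec d) (v i) ^ 2 ≤ B)
    {ε : ℝ} {N' : Finset Γ}
    (h1' : ∀ u ∈ N', ‖u‖ = 1) (hN' : ∀ x : Γ, ‖x‖ = 1 → ∃ u ∈ N', ‖x - u‖ ≤ ε) (hε : 0 < ε)
    (h' : ∀ u ∈ N', 3 / 4 * σ ^ 2 ≤ ∑ i, w i * inner ℝ (u : Vec d) (v i) ^ 2)
    (hεB : 4 * ε * B ≤ σ ^ 2 / 4) :
    σ ^ 2 / 2 ≤ kthEigenvalue (∑ i, w i • outer (v i) (v i)) k := by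
  have hC := norm_compression_sum_outer_le hw0 h1 hN hB h
  have hH := sum_smul_outer_isHermitian w v
  have hS := compression_isSymmetric (Matrix.isSymmetric_toEuclideanLin_iff.mpr hH) Γ
  have key : ∀ x : Γ, ‖x‖ = 1 → σ ^ 2 / 2 ≤
      inner ℝ (x : Vec d) (Matrix.toEuclideanLin (∑ i, w i • outer (v i) (v i)) x) := by
    intro x hx
    obtain ⟨u, hu, hxu⟩ := hN' x hx
    have h2 := inner_map_self_ge_of_close hS hx (h1' u hu) hxu
    rw [inner_compression, inner_compression, inner_sum_smul_outer_self] at h2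
    have h3 := h' u hu
    have h4 := mul_le_mul_of_nonneg_left hC (by positivity : 0 ≤ 2 * ε)
    linarith
  refine le_kthEigenvalue_of_le_inner hH hk hΓ fun x hx => ?_
  rcases eq_or_ne x 0 with rfl | hx0
  · simp
  have hx' : 0 < ‖x‖ := norm_pos_iff.2 hx0
  have := key ⟨‖x‖⁻¹ • x, Γ.smul_mem _ hx⟩ (by
    rw [Submodule.coe_norm, norm_smul, norm_inv, norm_norm, inv_mul_cancel₀ hx'.ne'])
  simp only [map_smul, inner_smul_left, inner_smul_right, RCLike.conj_to_real] at this
  refine (mul_le_mul_of_nonneg_right this (sq_nonneg ‖x‖)).trans (le_of_eq ?_)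
  field_simp

lemma log_one_div_nonneg {δ : ℝ} (hδ : 0 < δ) (hδ2 : δ < 1 / 2) : 0 ≤ Real.log (1 / δ) :=
  Real.log_nonneg (by rw [le_div_iff₀ hδ]; linarith)

/-- The weighted second moments of the means are bounded on a `1/4`-net of `Γ`. -/
lemma MeansAssumption.measure_iUnion_upper_le [IsProbabilityMeasure P]
    (h : MeansAssumption P M Γ k K σ) (hk : 1 ≤ k)
    (hK : 0 < K) (hσ : 0 < σ)
    {δ : ℝ} (hδ : 0 < δ) (hδ2 : δ < 1 / 2)
    (hw0 : ∀ i, 0 ≤ w i) (hw1 : ∑ i, w i = 1) (hwR : ∀ i, w i ≤ 1 / (k + Real.log (1 / δ)))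
    {N : Finset Γ} (h1 : ∀ u ∈ N, ‖u‖ = 1) (hN : (N.card : ℝ) ≤ 9 ^ k) :
    P (⋃ u ∈ N, {ω | 120 * K ^ 2 * σ ^ 2 ≤ ∑ i, w i * inner ℝ (u : Vec d) (M i ω) ^ 2}) ≤
      ENNReal.ofReal (δ / 32) := by
  have hR : 0 < k + Real.log (1 / δ) := by
    have := log_one_div_nonneg hδ hδ2
    have : (1 : ℝ) ≤ k := by exact_mod_cast hk
    linarith
  refine (measure_biUnion_finset_le_card_mul N _ hN fun u hu =>
    h.measure_upper_le hK hσ hw0 hw1 hR hwR (u := u) (h1 u hu)).trans ?_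
  refine ENNReal.ofReal_le_ofReal (pow_mul_exp_neg_le (g := 3) (by norm_num) (by norm_num)
    nine_le_exp_three hδ hδ2 (by norm_num))

lemma exists_isWeightConstant (hK : 0 < K) : ∃ Cs : ℝ, IsWeightConstant.{u} K Cs := by
  -- Solves `4ε · 120K²σ² = σ²/4`.
  set ε := 1 / (1920 * K ^ 2) with hε
  have hε0 : 0 < ε := by positivity
  set g := Real.log (1 + 2 / ε) with hg
  have hg0 : 0 ≤ g := Real.log_nonneg (by have : 0 < 2 / ε := by positivity
                                          linarith)
  -- Ensures `Cs/(512K⁴) ≥ g + 6`, the rate that beats the size `e^(gk)` of the fine net.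
  refine ⟨2 + 512 * K ^ 4 * (g + 6), by have : 0 ≤ 512 * K ^ 4 * (g + 6) := by positivity
                                        linarith, ?_⟩
  intro Ω _ P _ n d k M Γ σ δ w hk hσ hδ hδ2 hM hw0 hw1 hwC
  set Cs := 2 + 512 * K ^ 4 * (g + 6) with hCs
  have hCs1 : 1 ≤ Cs := by have : 0 ≤ 512 * K ^ 4 * (g + 6) := by positivity
                           linarith
  have hk' : (1 : ℝ) ≤ k := by exact_mod_cast hk
  have hL := log_one_div_nonneg hδ hδ2
  set L := Real.log (1 / δ) with hLdef
  have hR : 0 < k + L := by linarith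
  have hwR : ∀ i, w i ≤ 1 / (k + L) := fun i => (hwC i).trans
    (one_div_le_one_div_of_le hR (le_mul_of_one_le_left hR.le hCs1))
  obtain ⟨N, hN1, hNc, hN⟩ := exists_net_unitSphere Γ (ε := 1 / 4) (by norm_num)
  obtain ⟨N', hN1', hNc', hN'⟩ := exists_net_unitSphere Γ hε0
  rw [hM.finrank_eq] at hNc hNc'
  have p1 := hM.measure_iUnion_upper_le hk hK hσ hδ hδ2 hw0 hw1 hwR hN1
    (hNc.trans (le_of_eq (by norm_num)))
  have p2 : P (⋃ u ∈ N', {ω | ∑ i, w i * inner ℝ (u : Vec d) (M i ω) ^ 2 ≤ 3 / 4 * σ ^ 2}) ≤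
      ENNReal.ofReal (δ / 32) := by
    refine (measure_biUnion_finset_le_card_mul N' _ hNc' fun u hu =>
      hM.measure_lower_le hk hK hσ hw0 hw1 (by positivity : 0 < Cs * (k + L)) hwC u.2
        (hN1' u hu)).trans ?_
    refine ENNReal.ofReal_le_ofReal ?_
    rw [mul_div_right_comm]
    refine pow_mul_exp_neg_le (g := g) (by positivity) hg0 ?_ hδ hδ2 ?_
    · rw [hg, Real.exp_log (by positivity)]
    · rw [le_div_iff₀ (by positivity), hCs]; linarith
  have p0 : P {ω | ¬ ∀ i, M i ω ∈ Γ} = 0 := ae_iff.1 (ae_all_iff.2 hM.supported)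
  have hsub : {ω | ¬ σ ^ 2 / 2 ≤ kthEigenvalue (∑ i, w i • outer (M i ω) (M i ω)) k} ⊆
      (⋃ u ∈ N, {ω | 120 * K ^ 2 * σ ^ 2 ≤ ∑ i, w i * inner ℝ (u : Vec d) (M i ω) ^ 2}) ∪
      (⋃ u ∈ N', {ω | ∑ i, w i * inner ℝ (u : Vec d) (M i ω) ^ 2 ≤ 3 / 4 * σ ^ 2}) := by
    intro ω hω
    by_contra hcon
    simp only [Set.mem_union, Set.mem_iUnion, Set.mem_ofPred_eq, not_or, not_exists, not_le] at hcon
    refine hω (half_sq_le_kthEigenvalue_of_nets (σ := σ) hk hM.finrank_eq hw0 hN1 hN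
      (B := 120 * K ^ 2 * σ ^ 2) (by positivity) (fun u hu => (hcon.1 u hu).le) hN1' hN' hε0
      (fun u hu => (hcon.2 u hu).le) ?_)
    rw [hε]; apply le_of_eq; field_simp; norm_num
  refine (measure_mono hsub).trans ((measure_union_le _ _).trans ((add_le_add p1 p2).trans ?_))
  rw [← ENNReal.ofReal_add (by positivity) (by positivity)]
  exact ENNReal.ofReal_le_ofReal (by linarith)

end Means

/-! ### Noise terms for fixed means -/

section Noise

variable {Ω : Type*} [MeasurableSpace Ω] {P : Measure Ω}

lemma ProbabilityTheory.HasSubgaussianMGF.measure_abs_ge_le [IsProbabilityMeasure P] {X : Ω → ℝ}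
    {c : NNReal} (h : HasSubgaussianMGF X c P) {V t : ℝ} (hV : 0 < V) (hcV : c ≤ V)
    (ht : 0 ≤ t) :
    P {ω | t ≤ |X ω|} ≤ ENNReal.ofReal (2 * Real.exp (-(t ^ 2 / (2 * V)))) := by
  have hX := h.aemeasurable
  have key : ∀ l : ℝ, ∫⁻ ω, ENNReal.ofReal (Real.exp (l * X ω)) ∂P ≤
      ENNReal.ofReal (Real.exp (V * l ^ 2 / 2)) := fun l =>
    (h.lintegral_exp_le l).trans (ENNReal.ofReal_le_ofReal (Real.exp_le_exp.2 (by gcongr)))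
  have side : ∀ s : ℝ, s ^ 2 = 1 → P {ω | t ≤ s * X ω} ≤
      ENNReal.ofReal (Real.exp (-(t ^ 2 / (2 * V)))) := by
    intro s hs
    have := measure_le_of_lintegral_exp_le (t := t / V * t) (by fun_prop) (key (t / V * s))
    have e : V * (t / V * s) ^ 2 / 2 - t / V * t = -(t ^ 2 / (2 * V)) := by
      rw [mul_pow, hs]; field_simp; ring
    rw [e] at this
    refine (measure_mono fun ω hω => ?_).trans this
    simp only [Set.mem_ofPred_eq, mul_assoc] at hω ⊢
    gcongr
  have hsub : {ω | t ≤ |X ω|} ⊆ {ω | t ≤ 1 * X ω} ∪ {ω | t ≤ (-1) * X ω} := by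
    intro ω hω
    simp only [Set.mem_ofPred_eq, Set.mem_union, one_mul, neg_mul] at hω ⊢
    exact le_abs.1 hω
  refine (measure_mono hsub).trans ((measure_union_le _ _).trans
    ((add_le_add (side 1 (by norm_num)) (side (-1) (by norm_num))).trans ?_))
  rw [← ENNReal.ofReal_add (Real.exp_pos _).le (Real.exp_pos _).le, ← two_mul]

variable {n d : ℕ} {m : Fin n → ℕ} {z : (i : Fin n) → Fin (m i) → Ω → Vec d} {η w : Fin n → ℝ}

lemma hasSubgaussianMGF_inner [IsProbabilityMeasure P]
    (hsg : ∀ i j, HasSubGaussianConstVec (z i j) (η i) P) (h0 : ∀ i j, ∫ ω, z i j ω ∂P = 0)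
    {u : Vec d} (hu : ‖u‖ = 1) (i : Fin n) (j : Fin (m i)) :
    HasSubgaussianMGF (fun ω => inner ℝ u (z i j ω)) (Real.toNNReal (24 * η i ^ 2)) P :=
  (hsg i j u hu).hasSubgaussianMGF ((hsg i j).integral_inner_eq_zero (h0 i j) u)

/-- The part of the quadratic form at `u` of `pairwiseMatrix m w (v + z)` that is linear in the
noise `z`. -/
noncomputable def crossTerm (m : Fin n → ℕ) (w : Fin n → ℝ) (u : Vec d) (v : Fin n → Vec d)
    (z : (i : Fin n) → Fin (m i) → Vec d) : ℝ :=
  ∑ i, ∑ j, (2 * w i * inner ℝ u (v i) / m i) * inner ℝ u (z i j)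

/-- The part of the quadratic form at `u` of `pairwiseMatrix m w (v + z)` that is quadratic in the
noise `z`. -/
noncomputable def quadTerm (m : Fin n → ℕ) (w : Fin n → ℝ) (u : Vec d)
    (z : (i : Fin n) → Fin (m i) → Vec d) : ℝ :=
  ∑ i, (w i / ((m i : ℝ) * ((m i : ℝ) - 1))) *
    ∑ p ∈ (Finset.univ : Finset (Fin (m i))).offDiag, inner ℝ u (z i p.1) * inner ℝ u (z i p.2)

/-- For frozen means this is a linear form in independent noises. User `i` contributes proxy `96
(w_i η_i²/m_i)(w_i ⟨u, v_i⟩²)`; bounding the first factor by `ρ` and summing the second gives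
`96ρB`. -/
lemma measure_crossTerm_ge_le (hm : ∀ i, 2 ≤ m i)
    (hind : iIndepFun (fun (p : (i : Fin n) × Fin (m i)) => z p.1 p.2) P)
    (hsg : ∀ i j, HasSubGaussianConstVec (z i j) (η i) P) (h0 : ∀ i j, ∫ ω, z i j ω ∂P = 0)
    {u : Vec d} (hu : ‖u‖ = 1) (v : Fin n → Vec d) (hw0 : ∀ i, 0 ≤ w i) {ρ B t : ℝ} (hρ : 0 < ρ) (ht : 0 ≤ t)
    (hB : 0 < B)
    (hwq : ∀ i, w i * (η i ^ 2 / m i) ≤ ρ) (hv : ∑ i, w i * inner ℝ u (v i) ^ 2 ≤ B) :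
    P {ω | t ≤ |crossTerm m w u v (fun i j => z i j ω)|} ≤
      ENNReal.ofReal (2 * Real.exp (-(t ^ 2 / (192 * ρ * B)))) := by
  have := hind.isProbabilityMeasure
  set c : ((i : Fin n) × Fin (m i)) → ℝ := fun p => 2 * w p.1 * inner ℝ u (v p.1) / m p.1 with hc
  have hind' : iIndepFun (fun (p : (i : Fin n) × Fin (m i)) ω => c p * inner ℝ u (z p.1 p.2 ω)) P :=
    hind.comp (fun p x => c p * inner ℝ u x) fun p => by fun_prop
  set q : ((i : Fin n) × Fin (m i)) → NNReal := fun p => Real.toNNReal (c p ^ 2 * (24 * η p.1 ^ 2))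
    with hq
  have hS := HasSubgaussianMGF.sum_of_iIndepFun hind' (s := Finset.univ) (c := q) fun p _ => by
    refine ⟨fun t => ?_, fun t => ?_⟩
    · simpa only [mul_assoc] using
        (hasSubgaussianMGF_inner hsg h0 hu p.1 p.2).integrable_exp_mul (t * c p)
    · have h := (hasSubgaussianMGF_inner hsg h0 hu p.1 p.2).mgf_le (t * c p)
      rw [Real.coe_toNNReal _ (by positivity)] at h ⊢
      simp only [mgf, mul_assoc] at h ⊢
      refine h.trans (le_of_eq (congrArg Real.exp ?_))
      ring
  have hcoe : ((∑ p, q p : NNReal) : ℝ) ≤ 96 * ρ * B := by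
    rw [NNReal.coe_sum, Fintype.sum_sigma]
    calc _ ≤ ∑ i, 96 * ρ * (w i * inner ℝ u (v i) ^ 2) := by
          refine Finset.sum_le_sum fun i _ => ?_
          have hmi : (0 : ℝ) < m i := by have := hm i; positivity
          simp only [hq]
          rw [Finset.sum_congr rfl fun j _ => Real.coe_toNNReal _ (by positivity)]
          simp only [Finset.sum_const, Finset.card_univ, Fintype.card_fin, nsmul_eq_mul, hc]
          calc _ = 96 * (w i * (η i ^ 2 / m i)) * (w i * inner ℝ u (v i) ^ 2) := by
                field_simp; ring
            _ ≤ _ := by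
                have := mul_nonneg (hw0 i) (sq_nonneg (inner ℝ u (v i)))
                gcongr
                exact hwq i
      _ = 96 * ρ * ∑ i, w i * inner ℝ u (v i) ^ 2 := by rw [Finset.mul_sum]
      _ ≤ _ := by gcongr
  have := hS.measure_abs_ge_le (t := t) (by positivity) hcoe ht
  rw [show 2 * (96 * ρ * B) = 192 * ρ * B by ring] at this
  simpa only [crossTerm, Fintype.sum_sigma] using this

/-- The users factor, and decoupling handles each one. As `m/(m - 1) ≤ 2`, the constant is `4 · 24²
· 2² = 9216`; the condition on `l` keeps each exponent below `1/2` because `9216/136² < 1/2`. -/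
lemma lintegral_exp_quadTerm_le (hm : ∀ i, 2 ≤ m i) (hz : ∀ i j, Measurable (z i j))
    (hind : iIndepFun (fun (p : (i : Fin n) × Fin (m i)) => z p.1 p.2) P)
    (hsg : ∀ i j, HasSubGaussianConstVec (z i j) (η i) P) (h0 : ∀ i j, ∫ ω, z i j ω ∂P = 0)
    {u : Vec d} (hu : ‖u‖ = 1) (hw0 : ∀ i, 0 ≤ w i) (hw1 : ∑ i, w i = 1) {ρ l : ℝ}
    (hwq : ∀ i, w i * (η i ^ 2 / m i) ≤ ρ)
    {τ : ℝ} (hwq2 : ∀ i, w i * (η i ^ 2 / m i) ^ 2 ≤ τ) (hl : l ^ 2 * ρ ^ 2 ≤ 1 / 136 ^ 2) :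
    ∫⁻ ω, ENNReal.ofReal (Real.exp (l * quadTerm m w u (fun i j => z i j ω))) ∂P ≤
      ENNReal.ofReal (Real.exp (9216 * l ^ 2 * τ)) := by
  have := hind.isProbabilityMeasure
  set a : Fin n → ℝ := fun i => l * (w i / ((m i : ℝ) * ((m i : ℝ) - 1))) with ha
  have hindu : iIndepFun (fun (p : (i : Fin n) × Fin (m i)) ω => inner ℝ u (z p.1 p.2 ω)) P :=
    hind.comp (fun p x => inner ℝ u x) fun p => by fun_prop
  have e1 : ∀ ω, ENNReal.ofReal (Real.exp (l * quadTerm m w u (fun i j => z i j ω))) =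
      ∏ i ∈ Finset.univ, (fun (x : Fin (m i) → ℝ) => ENNReal.ofReal (Real.exp (a i *
        ∑ p ∈ (Finset.univ : Finset (Fin (m i))).offDiag, x p.1 * x p.2)))
          (fun j => inner ℝ u (z i j ω)) := by
    intro ω
    rw [prod_ofReal_exp, quadTerm, Finset.mul_sum]
    simp only [ha, mul_assoc]
  simp_rw [e1]
  rw [hindu.lintegral_prod_sigma (fun p => by fun_prop) (fun i (x : Fin (m i) → ℝ) =>
    ENNReal.ofReal (Real.exp (a i *
        ∑ p ∈ (Finset.univ : Finset (Fin (m i))).offDiag, x p.1 * x p.2))) (fun i => by fun_prop)]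
  have hbound : ∀ i, 4 * a i ^ 2 * (Real.toNNReal (24 * η i ^ 2) : ℝ) ^ 2 *
      (Fintype.card (Fin (m i)) : ℝ) ^ 2 ≤ 9216 * l ^ 2 * (w i * (η i ^ 2 / m i)) ^ 2 := by
    intro i
    have h2 : (2 : ℝ) ≤ m i := by exact_mod_cast hm i
    rw [Real.coe_toNNReal _ (by positivity), Fintype.card_fin]
    have h3 : ((m i : ℝ) / (m i - 1)) ^ 2 ≤ 2 ^ 2 := by
      gcongr
      · exact div_nonneg (by linarith) (by linarith)
      · rw [div_le_iff₀ (by linarith)]; linarith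
    have h4 : (m i : ℝ) - 1 ≠ 0 := by linarith
    calc _ = 2304 * l ^ 2 * (w i * (η i ^ 2 / m i)) ^ 2 * ((m i : ℝ) / (m i - 1)) ^ 2 := by
          simp only [ha]
          field_simp; ring
      _ ≤ 2304 * l ^ 2 * (w i * (η i ^ 2 / m i)) ^ 2 * 2 ^ 2 := by gcongr
      _ = _ := by ring
  have hhalf : ∀ i, 9216 * l ^ 2 * (w i * (η i ^ 2 / m i)) ^ 2 ≤ 1 / 2 := by
    intro i
    have hnn : 0 ≤ w i * (η i ^ 2 / m i) := mul_nonneg (hw0 i) (by positivity)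
    have := pow_le_pow_left₀ hnn (hwq i) 2
    have h5 := mul_le_mul_of_nonneg_left this (sq_nonneg l)
    have h6 : (9216 : ℝ) * (1 / 136 ^ 2) ≤ 1 / 2 := by norm_num
    linarith
  calc _ ≤ ∏ i, ENNReal.ofReal (Real.exp (9216 * l ^ 2 * (w i * τ))) := by
        refine Finset.prod_le_prod' fun i _ => ?_
        refine (lintegral_exp_sum_offDiag_le (y := fun j ω => inner ℝ u (z i j ω))
          (c := Real.toNNReal (24 * η i ^ 2))
          (hindu.precomp (g := fun j : Fin (m i) => (⟨i, j⟩ : (i : Fin n) × Fin (m i)))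
            fun _ _ h => eq_of_heq (Sigma.mk.inj h).2) (fun j => by fun_prop)
          (fun j => hasSubgaussianMGF_inner hsg h0 hu i j) ((hbound i).trans (hhalf i))).trans ?_
        refine ENNReal.ofReal_le_ofReal (Real.exp_le_exp.2 ((hbound i).trans ?_))
        gcongr
        calc (w i * (η i ^ 2 / m i)) ^ 2 = w i * (w i * (η i ^ 2 / m i) ^ 2) := by ring
          _ ≤ w i * τ := mul_le_mul_of_nonneg_left (hwq2 i) (hw0 i)
    _ = _ := by
        rw [prod_ofReal_exp, ← Finset.mul_sum, ← Finset.sum_mul, hw1, one_mul]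

lemma measure_quadTerm_ge_le (hm : ∀ i, 2 ≤ m i) (hz : ∀ i j, Measurable (z i j))
    (hind : iIndepFun (fun (p : (i : Fin n) × Fin (m i)) => z p.1 p.2) P)
    (hsg : ∀ i j, HasSubGaussianConstVec (z i j) (η i) P) (h0 : ∀ i j, ∫ ω, z i j ω ∂P = 0)
    {u : Vec d} (hu : ‖u‖ = 1) (hw0 : ∀ i, 0 ≤ w i) (hw1 : ∑ i, w i = 1) {σ S D : ℝ}
    (hσ : 0 < σ) (hS : 0 < S) (hD : 0 ≤ D) (hDS : D ≤ S)
    (hwq : ∀ i, w i * (η i ^ 2 / m i) ≤ σ ^ 2 / S)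
    (hwq2 : ∀ i, w i * (η i ^ 2 / m i) ^ 2 ≤ σ ^ 4 / S) :
    P {ω | 1300 * σ ^ 2 * Real.sqrt (D / S) ≤ |quadTerm m w u (fun i j => z i j ω)|} ≤
      ENNReal.ofReal (2 * Real.exp (-(9 * D))) := by
  have hr : Real.sqrt (D / S) ^ 2 = D / S := Real.sq_sqrt (by positivity)
  set r := Real.sqrt (D / S) with hrdef
  have hr0 : 0 ≤ r := Real.sqrt_nonneg _
  have hr1 : r ^ 2 ≤ 1 := by rw [hr, div_le_one hS]; exact hDS
  have hrS : r ^ 2 * S = D := by rw [hr]; field_simp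
  -- As `r ≤ 1`, this tilt is admissible. The exponent becomes `(9216/136² - 1300/136) D ≤ -9D`.
  set l := r * S / (136 * σ ^ 2) with hl
  have hmq : Measurable fun ω => quadTerm m w u (fun i j => z i j ω) := by
    unfold quadTerm; fun_prop
  have side : ∀ s : ℝ, s ^ 2 = 1 →
      P {ω | 1300 * σ ^ 2 * r ≤ s * quadTerm m w u (fun i j => z i j ω)} ≤
        ENNReal.ofReal (Real.exp (-(9 * D))) := by
    intro s hs
    have h1 := lintegral_exp_quadTerm_le hm hz hind hsg h0 hu hw0 hw1 (l := l * s) hwq hwq2 (by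
      rw [mul_pow, hs, hl, div_pow]
      calc _ = r ^ 2 / 136 ^ 2 := by field_simp
        _ ≤ _ := by gcongr)
    have h2 := measure_le_of_lintegral_exp_le (t := l * (1300 * σ ^ 2 * r))
      (hmq.const_mul _).aemeasurable h1
    have e : 9216 * (l * s) ^ 2 * (σ ^ 4 / S) - l * (1300 * σ ^ 2 * r) ≤ -(9 * D) := by
      rw [mul_pow, hs, ← hrS, hl]
      have : 9216 * ((r * S / (136 * σ ^ 2)) ^ 2 * 1) * (σ ^ 4 / S) -
          r * S / (136 * σ ^ 2) * (1300 * σ ^ 2 * r) =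
            (9216 / 136 ^ 2 - 1300 / 136) * (r ^ 2 * S) := by field_simp
      rw [this]
      have : 0 ≤ r ^ 2 * S := by positivity
      nlinarith
    refine (measure_mono fun ω hω => ?_).trans
      (h2.trans (ENNReal.ofReal_le_ofReal (Real.exp_le_exp.2 e)))
    simp only [Set.mem_ofPred_eq] at hω ⊢
    rw [mul_assoc l s]
    have : 0 ≤ l := by positivity
    gcongr
  have hsub : {ω | 1300 * σ ^ 2 * r ≤ |quadTerm m w u (fun i j => z i j ω)|} ⊆
      {ω | 1300 * σ ^ 2 * r ≤ 1 * quadTerm m w u (fun i j => z i j ω)} ∪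
      {ω | 1300 * σ ^ 2 * r ≤ (-1) * quadTerm m w u (fun i j => z i j ω)} := by
    intro ω hω
    simp only [Set.mem_ofPred_eq, Set.mem_union, one_mul, neg_mul] at hω ⊢
    exact le_abs.1 hω
  refine (measure_mono hsub).trans ((measure_union_le _ _).trans
    ((add_le_add (side 1 (by norm_num)) (side (-1) (by norm_num))).trans ?_))
  rw [← ENNReal.ofReal_add (Real.exp_pos _).le (Real.exp_pos _).le, two_mul]

/-- Exact, because the squares of the individual noises are absent. Each noise meets `m_i - 1`
partners on either side, which turns the prefactor into `2 w_i/m_i`. -/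
lemma inner_pairwiseMatrix (hm : ∀ i, 2 ≤ m i) (w : Fin n → ℝ) (u : Vec d) (v : Fin n → Vec d)
    (x : (i : Fin n) → Fin (m i) → Vec d) :
    inner ℝ u (Matrix.toEuclideanLin (pairwiseMatrix m w (fun i j => v i + x i j)) u) =
      inner ℝ u (Matrix.toEuclideanLin (∑ i, w i • outer (v i) (v i)) u) +
        (crossTerm m w u v x + quadTerm m w u x) := by
  rw [inner_sum_smul_outer_self, crossTerm, quadTerm, ← Finset.sum_add_distrib,
    ← Finset.sum_add_distrib, pairwiseMatrix, map_sum, LinearMap.sum_apply, inner_sum]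
  refine Finset.sum_congr rfl fun i _ => ?_
  have h2 : (2 : ℝ) ≤ m i := by exact_mod_cast hm i
  have h4 : (m i : ℝ) - 1 ≠ 0 := by linarith
  have h5 : (m i : ℝ) ≠ 0 := by linarith
  rw [map_smul, LinearMap.smul_apply, inner_smul_right, map_sum, LinearMap.sum_apply, inner_sum]
  have e : ∑ p ∈ (Finset.univ : Finset (Fin (m i))).offDiag,
      inner ℝ u (Matrix.toEuclideanLin (outer (v i + x i p.1) (v i + x i p.2)) u) =
      ∑ p ∈ (Finset.univ : Finset (Fin (m i))).offDiag,
        (inner ℝ u (v i) + inner ℝ u (x i p.1)) * (inner ℝ u (v i) + inner ℝ u (x i p.2)) := by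
    refine Finset.sum_congr rfl fun p _ => ?_
    rw [inner_toEuclideanLin_outer, real_inner_comm u (v i + x i p.2), inner_add_right,
      inner_add_right]
  rw [e, Finset.sum_offDiag_mul_self _ fun j => inner ℝ u (v i) + inner ℝ u (x i j),
    Finset.sum_offDiag_mul_self _ fun j => inner ℝ u (x i j)]
  simp only [add_sq, Finset.sum_add_distrib, ← Finset.mul_sum, Finset.sum_const, Finset.card_univ,
    Fintype.card_fin, nsmul_eq_mul]
  field_simp
  ring

end Noise

/-! ### From a net bound on the noise to the angle -/

section Angle

variable {n d k : ℕ} {m : Fin n → ℕ} {w : Fin n → ℝ} {Γ : Submodule ℝ (Vec d)} {σ : ℝ}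

lemma sin_maxPrincipalAngle_le (V W : Submodule ℝ (Vec d)) :
    Real.sin (maxPrincipalAngle V W) ≤ ‖V.starProjection - W.starProjection‖ := by
  rw [maxPrincipalAngle]
  rcases le_total ‖V.starProjection - W.starProjection‖ 1 with h | h
  · rw [Real.sin_arcsin (by linarith [norm_nonneg (V.starProjection - W.starProjection)]) h]
  · exact (Real.sin_le_one _).trans h

lemma sin_maxPrincipalAngle_le_of_net (hm : ∀ i, 2 ≤ m i) (hk : 1 ≤ k)
    (hΓ : Module.finrank ℝ Γ = k) (hσ : 0 < σ) {v : Fin n → Vec d} (hv : ∀ i, v i ∈ Γ)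
    (hkth : σ ^ 2 / 2 ≤ kthEigenvalue (∑ i, w i • outer (v i) (v i)) k)
    {N : Finset (Vec d)} (h1 : ∀ u ∈ N, ‖u‖ = 1)
    (hN : ∀ x : Vec d, ‖x‖ = 1 → ∃ u ∈ N, ‖x - u‖ ≤ 1 / 4)
    {x : (i : Fin n) → Fin (m i) → Vec d} {B : ℝ} (hB : 0 ≤ B)
    (h : ∀ u ∈ N, |crossTerm m w u v x + quadTerm m w u x| ≤ B) {Γhat : Submodule ℝ (Vec d)}
    (htop : IsTopEigenspace (pairwiseMatrix m w (fun i j => v i + x i j)) k Γhat) :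
    Real.sin (maxPrincipalAngle Γ Γhat) ≤ 8 * B / σ ^ 2 := by
  obtain ⟨b, lam, hlam, hb, rfl⟩ := htop
  set T := Matrix.toEuclideanLin (pairwiseMatrix m w (fun i j => v i + x i j)) with hT
  set T₀ := Matrix.toEuclideanLin (∑ i, w i • outer (v i) (v i)) with hT₀
  have hH := sum_smul_outer_isHermitian w v
  have hs₀ : T₀.IsSymmetric := Matrix.isSymmetric_toEuclideanLin_iff.mpr hH
  have hs : T.IsSymmetric := b.isSymmetric_of_eigen hb
  set D := LinearMap.toContinuousLinearMap (T - T₀) with hD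
  have hnorm : ‖D‖ ≤ 2 * B := by
    refine norm_le_two_mul_of_net (T := D) (hs.sub hs₀) h1 hN hB fun u hu => ?_
    have e : inner ℝ u (D u) = crossTerm m w u v x + quadTerm m w u x := by
      rw [hD, LinearMap.coe_toContinuousLinearMap', LinearMap.sub_apply, inner_sub_right, hT, hT₀,
        inner_pairwiseMatrix hm]
      ring
    rw [e]
    exact h u hu
  have hmem : ∀ x, T₀ x ∈ Γ := sum_smul_outer_mem w v hv
  -- Davis–Kahan with `e = 2B` and `s = σ²/2` gives `2e/s = 8B/σ²`. If `2e > s`, that bound exceeds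
  -- `1` and is trivial.
  rcases le_or_gt (2 * (2 * B)) (σ ^ 2 / 2) with hle | hgt
  · refine (sin_maxPrincipalAngle_le _ _).trans ((norm_starProjection_sub_span_le b hlam hb hs₀ hmem
      (s := σ ^ 2 / 2) (e := 2 * B) (by positivity) (by positivity) hle (fun y hy =>
        le_inner_of_le_kthEigenvalue hH hmem hk hΓ (by positivity) hkth hy) (fun y => ?_)
      hΓ).trans (le_of_eq ?_))
    · exact (D.le_opNorm y).trans (by gcongr)
    · field_simp; ring
  · refine (Real.sin_le_one _).trans ?_
    rw [le_div_iff₀ (by positivity)]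
    linarith

end Angle

/-! ### What the information weights guarantee -/

section Info

variable {n k : ℕ} {m : Fin n → ℕ} {σ : ℝ} {η : Fin n → ℝ} {γ γ' : Fin n → ℝ≥0∞}

lemma truncInfo_le (hk : 1 ≤ k) (hkn : k ≤ n) (hγ : Antitone γ) (i : Fin n) :
    truncInfo k hk hkn γ i ≤ γ i := by
  unfold truncInfo
  split_ifs with h
  · exact le_rfl
  · exact hγ (by rw [Fin.le_def]; simp only; omega)

lemma truncInfo_le_of_val_eq_zero (hk : 1 ≤ k) (hkn : k ≤ n) (hγ : Antitone γ) (i : Fin n)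
    {j : Fin n} (hj : j.val = 0) : truncInfo k hk hkn γ i ≤ truncInfo k hk hkn γ j := by
  unfold truncInfo
  split_ifs with h h' h'
  · exact hγ (by rw [Fin.le_def]; omega)
  · exact hγ (by rw [Fin.le_def]; simp only; omega)
  · omega
  · exact le_rfl

lemma info_ne_zero (σ η : ℝ) (m : ℕ) : info σ η m ≠ 0 := by
  simp [info]

/-- The reciprocal of `info` is a sum of two nonnegative terms, so `g` times either is at most `1`.
The first bound serves the cross term; both serve the quadratic term. -/
lemma mul_sq_div_le_of_le_info {σ η : ℝ} {m : ℕ} (hσ : 0 < σ) {g : ℝ≥0∞}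
    (h : g ≤ info σ η m) :
    g.toReal * (η ^ 2 / m) ≤ σ ^ 2 ∧ g.toReal * (η ^ 2 / m) ^ 2 ≤ σ ^ 4 := by
  rw [info, ENNReal.le_inv_iff_mul_le] at h
  have h1 := ENNReal.toReal_mono ENNReal.one_ne_top h
  rw [ENNReal.toReal_mul, ENNReal.toReal_ofReal (by positivity), ENNReal.toReal_one] at h1
  have hg0 : 0 ≤ g.toReal := ENNReal.toReal_nonneg
  have e1 : η ^ 2 / (σ ^ 2 * m) = (η ^ 2 / m) / σ ^ 2 := by rw [div_div, mul_comm]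
  have e2 : η ^ 4 / (σ ^ 4 * (m : ℝ) ^ 2) = (η ^ 2 / m) ^ 2 / σ ^ 4 := by
    rw [div_pow, div_div, mul_comm (σ ^ 4)]; ring
  rw [e1, e2, mul_add] at h1
  have a1 : 0 ≤ g.toReal * ((η ^ 2 / m) / σ ^ 2) := by positivity
  have a2 : 0 ≤ g.toReal * ((η ^ 2 / m) ^ 2 / σ ^ 4) := by positivity
  constructor
  · have : g.toReal * ((η ^ 2 / m) / σ ^ 2) ≤ 1 := by linarith
    rwa [← mul_div_assoc, div_le_one (by positivity)] at this
  · have : g.toReal * ((η ^ 2 / m) ^ 2 / σ ^ 4) ≤ 1 := by linarith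
    rwa [← mul_div_assoc, div_le_one (by positivity)] at this

end Info

/-! ### Conditioning on the means and union bounds -/

section Conditional

/-- Disintegration along `X`: a bound on almost every section integrates to a bound on the joint
event, so the noise may be treated with the means frozen. -/
lemma measure_le_of_condDistrib {Ω α β : Type*} [MeasurableSpace Ω] [MeasurableSpace α]
    [MeasurableSpace β] [StandardBorelSpace β] [Nonempty β] {P : Measure Ω} [IsProbabilityMeasure P]
    {X : Ω → α} {Y : Ω → β} (hX : Measurable X) (hY : Measurable Y) {B : Set (α × β)}
    (hB : MeasurableSet B) {e : ℝ≥0∞}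
    (h : ∀ᵐ v ∂(P.map X), condDistrib Y X P v (Prod.mk v ⁻¹' B) ≤ e) :
    P {ω | (X ω, Y ω) ∈ B} ≤ e := by
  have : IsProbabilityMeasure (P.map X) := Measure.isProbabilityMeasure_map hX.aemeasurable
  calc P {ω | (X ω, Y ω) ∈ B} = (P.map fun ω => (X ω, Y ω)) B :=
        (Measure.map_apply (hX.prodMk hY) hB).symm
    _ = ∫⁻ v, condDistrib Y X P v (Prod.mk v ⁻¹' B) ∂(P.map X) := by
        rw [← compProd_map_condDistrib hY.aemeasurable, Measure.compProd_apply hB]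
    _ ≤ ∫⁻ _, e ∂(P.map X) := lintegral_mono_ae h
    _ = e := by simp

variable {Ω : Type*} [MeasurableSpace Ω] {P : Measure Ω} [IsProbabilityMeasure P] {n d : ℕ}
  {m : Fin n → ℕ} {M : Fin n → Ω → Vec d} {Z : (i : Fin n) → Fin (m i) → Ω → Vec d}
  {η w : Fin n → ℝ} {K σ δ S : ℝ} {N : Finset (Vec d)}

lemma net_card_mul_exp_le (hδ : 0 < δ) (hδ2 : δ < 1 / 2) :
    (1 + 2 / (1 / 4) : ℝ) ^ d * (2 * Real.exp (-(9 * (d + Real.log (1 / δ))))) ≤ δ / 16 := by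
  have := pow_mul_exp_neg_le (k := d) (G := 1 + 2 / (1 / 4)) (g := 3) (a := 9) (by norm_num)
    (by norm_num) ((by norm_num : (1 + 2 / (1 / 4) : ℝ) = 9).le.trans nine_le_exp_three) hδ hδ2
    (by norm_num)
  linarith

lemma NoiseAssumption.measure_iUnion_crossTerm_le (hZ : NoiseAssumption P m M Z η)
    (hM : ∀ i, Measurable (M i)) (hm : ∀ i, 2 ≤ m i) (hK : 0 < K) (hσ : 0 < σ) (hδ : 0 < δ)
    (hδ2 : δ < 1 / 2) (hw0 : ∀ i, 0 ≤ w i) (hS : 0 < S) (hd : (1 : ℝ) ≤ d)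
    (hwq : ∀ i, w i * (η i ^ 2 / m i) ≤ σ ^ 2 / S)
    (hN1 : ∀ u ∈ N, ‖u‖ = 1) (hNc : (N.card : ℝ) ≤ (1 + 2 / (1 / 4)) ^ d) :
    P (⋃ u ∈ N, {ω | ∑ i, w i * inner ℝ u (M i ω) ^ 2 ≤ 2 * (120 * K ^ 2 * σ ^ 2) ∧
      644 * K * σ ^ 2 * Real.sqrt ((d + Real.log (1 / δ)) / S) ≤
        |crossTerm m w u (fun i => M i ω) (fun i j => Z i j ω)|}) ≤ ENNReal.ofReal (δ / 16) := by
  have hL := log_one_div_nonneg hδ hδ2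
  set L := Real.log (1 / δ) with hLdef
  have hr0 : 0 ≤ Real.sqrt ((d + L) / S) := Real.sqrt_nonneg _
  have hr : Real.sqrt ((d + L) / S) ^ 2 = (d + L) / S := Real.sq_sqrt (by positivity)
  set r := Real.sqrt ((d + L) / S)
  have hX : Measurable fun ω i => M i ω := measurable_pi_lambda _ hM
  have hY : Measurable fun ω i j => Z i j ω :=
    measurable_pi_lambda _ fun i => measurable_pi_lambda _ fun j => hZ.measurable i j
  refine (measure_biUnion_finset_le_card_mul N _ hNc fun u hu => ?_).trans
    (ENNReal.ofReal_le_ofReal (net_card_mul_exp_le hδ hδ2))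
  have hc : Measurable fun p : (Fin n → Vec d) × ((i : Fin n) → Fin (m i) → Vec d) =>
      crossTerm m w u p.1 p.2 := by unfold crossTerm; fun_prop
  refine measure_le_of_condDistrib (B := {p | ∑ i, w i * inner ℝ u (p.1 i) ^ 2 ≤
      2 * (120 * K ^ 2 * σ ^ 2)} ∩ {p | 644 * K * σ ^ 2 * r ≤ |crossTerm m w u p.1 p.2|}) hX hY
    ((measurableSet_le (by fun_prop) (by fun_prop)).inter (measurableSet_le (by fun_prop) hc.abs)) ?_
  filter_upwards [hZ.conditional] with v hv
  obtain ⟨hind, hz⟩ := hv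
  generalize condDistrib (fun ω i j => Z i j ω) (fun ω i => M i ω) P v = μ at hind hz ⊢
  -- The restriction on the means is part of the event, so the section over bad means is empty.
  by_cases hgood : ∑ i, w i * inner ℝ u (v i) ^ 2 ≤ 2 * (120 * K ^ 2 * σ ^ 2)
  · have h := measure_crossTerm_ge_le (P := μ) (z := fun i j z => z i j) hm hind (fun i j => (hz i j).2)
      (fun i j => (hz i j).1) (hN1 u hu) v hw0 (ρ := σ ^ 2 / S)
      (B := 2 * (120 * K ^ 2 * σ ^ 2)) (t := 644 * K * σ ^ 2 * r) (by positivity) (by positivity)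
      (by positivity) hwq hgood
    refine (measure_mono fun z hz => hz.2).trans (h.trans (ENNReal.ofReal_le_ofReal ?_))
    -- The constant `644` is chosen so that `644²/(192 · 240)` just exceeds the rate `9` needed for
    -- a net of at most `9^d` points.
    have e : (644 * K * σ ^ 2 * r) ^ 2 / (192 * (σ ^ 2 / S) * (2 * (120 * K ^ 2 * σ ^ 2))) =
        414736 / 46080 * (d + L) := by
      rw [mul_pow, hr]
      field_simp
      ring
    rw [e]
    gcongr
    norm_num
  · refine (measure_mono_null (fun z hz => ?_) measure_empty).le.trans zero_le
    exact absurd hz.1 hgood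

lemma NoiseAssumption.measure_iUnion_quadTerm_le (hZ : NoiseAssumption P m M Z η)
    (hM : ∀ i, Measurable (M i)) (hm : ∀ i, 2 ≤ m i) (hσ : 0 < σ) (hδ : 0 < δ)
    (hδ2 : δ < 1 / 2) (hw0 : ∀ i, 0 ≤ w i) (hw1 : ∑ i, w i = 1) (hS : 0 < S)
    (hDS : d + Real.log (1 / δ) ≤ S)
    (hwq : ∀ i, w i * (η i ^ 2 / m i) ≤ σ ^ 2 / S)
    (hwq2 : ∀ i, w i * (η i ^ 2 / m i) ^ 2 ≤ σ ^ 4 / S)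
    (hN1 : ∀ u ∈ N, ‖u‖ = 1) (hNc : (N.card : ℝ) ≤ (1 + 2 / (1 / 4)) ^ d) :
    P (⋃ u ∈ N, {ω | 1300 * σ ^ 2 * Real.sqrt ((d + Real.log (1 / δ)) / S) ≤
        |quadTerm m w u (fun i j => Z i j ω)|}) ≤ ENNReal.ofReal (δ / 16) := by
  have hL := log_one_div_nonneg hδ hδ2
  have hX : Measurable fun ω i => M i ω := measurable_pi_lambda _ hM
  have hY : Measurable fun ω i j => Z i j ω :=
    measurable_pi_lambda _ fun i => measurable_pi_lambda _ fun j => hZ.measurable i j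
  refine (measure_biUnion_finset_le_card_mul N _ hNc fun u hu => ?_).trans
    (ENNReal.ofReal_le_ofReal (net_card_mul_exp_le hδ hδ2))
  have hc : Measurable fun p : (Fin n → Vec d) × ((i : Fin n) → Fin (m i) → Vec d) =>
      quadTerm m w u p.2 := by unfold quadTerm; fun_prop
  refine measure_le_of_condDistrib (B := {p | 1300 * σ ^ 2 *
    Real.sqrt ((d + Real.log (1 / δ)) / S) ≤ |quadTerm m w u p.2|}) hX hY
    (measurableSet_le (by fun_prop) hc.abs) ?_
  filter_upwards [hZ.conditional] with v hv
  obtain ⟨hind, hz⟩ := hv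
  generalize condDistrib (fun ω i j => Z i j ω) (fun ω i => M i ω) P v = μ at hind hz ⊢
  exact measure_quadTerm_ge_le (P := μ) (z := fun i j z => z i j) hm (fun i j => by fun_prop) hind
    (fun i j => (hz i j).2) (fun i j => (hz i j).1) (hN1 u hu) hw0 hw1 hσ hS (by positivity)
    hDS hwq hwq2

end Conditional

/-! ### Assembly of the main theorem -/

theorem theorem3p4 (K : ℝ) (hK : 0 < K) :
    (∃ Cs : ℝ, IsWeightConstant.{u} K Cs) ∧
    ∃ C : ℝ, 0 < C ∧ ∀ Cs : ℝ, IsWeightConstant.{u} K Cs →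
      ∀ (Ω : Type u) [MeasurableSpace Ω] (P : Measure Ω) [IsProbabilityMeasure P]
        (n d k : ℕ) (hk : 1 ≤ k) (hkn : k ≤ n)
        (m : Fin n → ℕ) (M : Fin n → Ω → Vec d) (Z : (i : Fin n) → Fin (m i) → Ω → Vec d)
        (Γ : Submodule ℝ (Vec d)) (σ δ : ℝ) (η : Fin n → ℝ)
        (γ γ' : Fin n → ℝ≥0∞) (w : Fin n → ℝ),
        (∀ i, 2 ≤ m i) → 0 < σ → (∀ i, 0 ≤ η i) → 0 < δ → δ < 1 / 2 →
        MeansAssumption P M Γ k K σ →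
        NoiseAssumption P m M Z η →
        (∀ i, γ i = info σ (η i) (m i)) → Antitone γ →
        (∀ i, γ' i = truncInfo k hk hkn γ i) → (∀ i, γ' i ≠ ∞) →
        Cs * (k + Real.log (1 / δ)) * (γ' ⟨0, by omega⟩).toReal ≤ ∑ i, (γ' i).toReal →
        (∀ i, w i = (γ' i).toReal / ∑ l, (γ' l).toReal) →
        P {ω | ¬ ∀ Γhat : Submodule ℝ (Vec d),
            IsTopEigenspace (pairwiseMatrix m w (fun i j => M i ω + Z i j ω)) k Γhat →
            Real.sin (maxPrincipalAngle Γ Γhat)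
              ≤ C * Real.sqrt ((d + Real.log (1 / δ)) / ∑ i, (γ' i).toReal)}
          ≤ ENNReal.ofReal δ := by
  refine ⟨exists_isWeightConstant hK, 8 * (644 * K + 1300), by positivity, ?_⟩
  intro Cs hCs Ω _ P _ n d k hk hkn m M Z Γ σ δ η γ γ' w hm hσ hη hδ hδ2 hM hZ hγ hanti hγ' hfin hsum hw
  have hk' : (1 : ℝ) ≤ k := by exact_mod_cast hk
  have hL := log_one_div_nonneg hδ hδ2
  set L := Real.log (1 / δ) with hLdef
  have hR : 0 < k + L := by linarith
  have hkd : k ≤ d := by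
    have := Γ.finrank_le
    rwa [hM.finrank_eq, finrank_euclideanSpace, Fintype.card_fin] at this
  have hd' : (1 : ℝ) ≤ d := by exact_mod_cast hk.trans hkd
  have hD : 0 < d + L := by linarith
  have hgpos : ∀ i, 0 < (γ' i).toReal := by
    intro i
    refine ENNReal.toReal_pos ?_ (hfin i)
    rw [hγ', truncInfo]
    split_ifs <;> rw [hγ] <;> exact info_ne_zero _ _ _
  -- Truncation only lowers the information, so the per-user noise bounds survive it.
  have hgle : ∀ i, γ' i ≤ info σ (η i) (m i) := fun i => by
    rw [← hγ, hγ']; exact truncInfo_le hk hkn hanti i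
  set S := ∑ i, (γ' i).toReal with hS
  have hSpos : 0 < S := Finset.sum_pos (fun i _ => hgpos i) ⟨⟨0, by omega⟩, Finset.mem_univ _⟩
  have hw0 : ∀ i, 0 ≤ w i := fun i => by rw [hw]; exact div_nonneg (hgpos i).le hSpos.le
  have hw1 : ∑ i, w i = 1 := by
    simp_rw [hw]; rw [← Finset.sum_div]; exact div_self hSpos.ne'
  have hwC : ∀ i, w i ≤ 1 / (Cs * (k + L)) := by
    intro i
    have hCsR : 0 < Cs * (k + L) := mul_pos (by linarith [hCs.1]) hR
    rw [hw, div_le_div_iff₀ hSpos hCsR, one_mul]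
    refine le_trans ?_ hsum
    rw [mul_comm]
    refine mul_le_mul_of_nonneg_left (ENNReal.toReal_mono (hfin _) ?_) hCsR.le
    rw [hγ', hγ']; exact truncInfo_le_of_val_eq_zero hk hkn hanti i rfl
  have hwR : ∀ i, w i ≤ 1 / (k + L) := fun i => (hwC i).trans
    (one_div_le_one_div_of_le hR (le_mul_of_one_le_left hR.le hCs.1.le))
  have hwq : ∀ i, w i * (η i ^ 2 / m i) ≤ σ ^ 2 / S := fun i => by
    rw [hw, div_mul_eq_mul_div]
    have := (mul_sq_div_le_of_le_info hσ (hgle i)).1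
    gcongr
  have hwq2 : ∀ i, w i * (η i ^ 2 / m i) ^ 2 ≤ σ ^ 4 / S := fun i => by
    rw [hw, div_mul_eq_mul_div]
    have := (mul_sq_div_le_of_le_info hσ (hgle i)).2
    gcongr
  -- When `S < d + L` the claimed bound is at least `1`. Otherwise `r ≤ 1`, as the tilt for the
  -- quadratic term requires.
  rcases lt_or_ge S (d + L) with hDS | hDS
  · have hempty : ∀ Γhat : Submodule ℝ (Vec d), Real.sin (maxPrincipalAngle Γ Γhat) ≤
        8 * (644 * K + 1300) * Real.sqrt ((d + L) / S) := by
      intro Γhat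
      refine (Real.sin_le_one _).trans ?_
      have h1 : 1 ≤ Real.sqrt ((d + L) / S) := by
        rw [Real.one_le_sqrt, le_div_iff₀ hSpos]; linarith
      nlinarith
    simp [hempty]
  set r := Real.sqrt ((d + L) / S) with hr
  have hr0 : 0 ≤ r := Real.sqrt_nonneg _
  obtain ⟨N₀, hN₀1, hN₀c, hN₀⟩ := exists_net_unitSphere Γ (ε := 1 / 4) (by norm_num)
  obtain ⟨N, hN1, hNc, hN⟩ := exists_net_unitSphere (Vec d) (ε := 1 / 4) (by norm_num)
  rw [hM.finrank_eq] at hN₀c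
  rw [finrank_euclideanSpace, Fintype.card_fin] at hNc
  have p₁ := hZ.measure_iUnion_crossTerm_le hM.measurable hm hK hσ hδ hδ2 hw0 hSpos hd' hwq hN1 hNc
  have p₂ := hZ.measure_iUnion_quadTerm_le hM.measurable hm hσ hδ hδ2 hw0 hw1 hSpos hDS hwq hwq2
    hN1 hNc
  have p₃ := hM.measure_iUnion_upper_le hk hK hσ hδ hδ2 hw0 hw1 hwR hN₀1
    (hN₀c.trans (le_of_eq (by norm_num)))
  have p₄ := hCs.2 Ω P n d k M Γ σ δ w hk hσ hδ hδ2 hM hw0 hw1 hwC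
  have p₀ : P {ω | ¬ ∀ i, M i ω ∈ Γ} = 0 := ae_iff.1 (ae_all_iff.2 hM.supported)
  -- The failure probabilities are `0`, `δ/2`, `δ/32`, `δ/16` and `δ/16`, with sum below `δ`.
  refine (measure_mono (t := {ω | ¬ ∀ i, M i ω ∈ Γ} ∪
    ({ω | ¬ σ ^ 2 / 2 ≤ kthEigenvalue (∑ i, w i • outer (M i ω) (M i ω)) k} ∪
    ((⋃ u ∈ N₀, {ω | 120 * K ^ 2 * σ ^ 2 ≤ ∑ i, w i * inner ℝ (u : Vec d) (M i ω) ^ 2}) ∪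
    ((⋃ u ∈ N, {ω | ∑ i, w i * inner ℝ u (M i ω) ^ 2 ≤ 2 * (120 * K ^ 2 * σ ^ 2) ∧
      644 * K * σ ^ 2 * r ≤ |crossTerm m w u (fun i => M i ω) (fun i j => Z i j ω)|}) ∪
    (⋃ u ∈ N, {ω | 1300 * σ ^ 2 * r ≤ |quadTerm m w u (fun i j => Z i j ω)|}))))) ?_).trans ?_
  · intro ω hω
    by_contra hcon
    simp only [Set.mem_union, not_or, Set.mem_iUnion, not_exists, Set.mem_ofPred_eq, not_not,
      not_and, not_le] at hcon
    obtain ⟨c₀, c₁, c₂, c₃, c₄⟩ := hcon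
    refine hω fun Γhat htop => ?_
    have hv2 : ∀ u ∈ N, ∑ i, w i * inner ℝ u (M i ω) ^ 2 ≤ 2 * (120 * K ^ 2 * σ ^ 2) := fun u hu =>
      sum_inner_sq_le_of_net c₀ hw0 hN₀1 hN₀ (by positivity) (fun x hx => (c₂ x hx).le) (hN1 u hu)
    refine (sin_maxPrincipalAngle_le_of_net (B := (644 * K + 1300) * σ ^ 2 * r) hm hk hM.finrank_eq
      hσ c₀ (not_lt.1 c₁) hN1 hN (by positivity) (fun u hu => ?_) htop).trans (le_of_eq ?_)
    · have h1 : |crossTerm m w u (fun i => M i ω) (fun i j => Z i j ω)| < 644 * K * σ ^ 2 * r :=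
        c₃ u hu (hv2 u hu)
      have h2 : |quadTerm m w u (fun i j => Z i j ω)| < 1300 * σ ^ 2 * r :=
        c₄ u hu
      refine (abs_add_le _ _).trans ?_
      linarith
    · field_simp
  · refine (measure_union_le _ _).trans ((add_le_add p₀.le ((measure_union_le _ _).trans
      (add_le_add p₄ ((measure_union_le _ _).trans (add_le_add p₃ ((measure_union_le _ _).trans
        (add_le_add p₁ p₂))))))).trans ?_)
    rw [zero_add, ← ENNReal.ofReal_add (by positivity) (by positivity),
      ← ENNReal.ofReal_add (by positivity) (by positivity),
      ← ENNReal.ofReal_add (by positivity) (by positivity)]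
    exact ENNReal.ofReal_le_ofReal (by linarith)
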